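/- Let $q\in\mathbb C$ be such that $q^2$ has finite multiplicative order $\ell=|q^2|\geq 3$. For integers $t,n\geq 0$ let $W_t(n)$ be the cell module of the Temperley--Lieb algebra $\mathrm{TL}_n(q)$ with loop parameter $-(q+q^{-1})$: the complex vector space whose basis is the set of monic Temperley--Lieb diagrams from $t$ to $n$, that is, of planar perfect matchings of $t$ points on the bottom edge and $n$ points on the top edge of a rectangle in which every bottom point is joined to a top point. Its invariant bilinear form is defined on monic diagrams as follows: let $D_1^*$ be the reflection of $D_1$ in a horizontal line, and form the composite $D_1^*D_2:t\to t$, in which each closed loop is replaced by the factor $-(q+q^{-1})$. If $D_1^*D_2$ is monic, then it is a multiple of the identity diagram and $(D_1,D_2)$ is this multiple, $D_1^*D_2=(D_1,D_2)\,\mathrm{id}_t$; otherwise $(D_1,D_2)=0$. Let $\mathrm{Rad}_t(n)$ be the radical of this form, let $L_t(n)=W_t(n)/\mathrm{Rad}_t(n)$, and put $$W_t(x)=\sum_{k\geq 0}\dim W_t(t+2k)\,x^k,\qquad L_t(x)=\sum_{k\geq 0}\dim L_t(t+2k)\,x^k .$$ Let $c(x)=\sum_{n\geq 0}\frac{1}{n+1}\binom{2n}{n}x^n$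 be the Catalan series, let $d(x)=c(x)-1$, and let $b(t)$ be the remainder of $t$ modulo $\ell$, so that $0\leq b(t)\leq \ell-1$. Then for every integer $t\geq 0$ the following identities of formal power series hold. If $b(t)=\ell-1$, then $$L_t(x)=W_t(x)=c(x)^{t+1}.$$ If $0\leq b(t)\leq \ell-2$, then $$L_t(x)=\frac{(d(x)+1)^{t+1}\,\bigl(1-d(x)^{\ell-1-b(t)}\bigr)}{1-d(x)^{\ell}} .$$ -/

import Mathlib

open PowerSeries

/-- The position of a boundary point of a rectangle with `s` points on the bottom edge (`Sum.inl`,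
numbered from left to right) and `n` points on the top edge (`Sum.inr`, numbered from left to
right), read off by going once around the boundary: along the bottom edge from left to right and
then along the top edge from right to left. -/
def boundaryPos (s n : ℕ) : Fin s ⊕ Fin n → ℕ
  | Sum.inl i => i
  | Sum.inr j => s + (n - 1 - j)

/-- A Temperley-Lieb diagram from `s` to `n`: a planar perfect matching of `s` bottom points and
`n` top points of a rectangle. The map `mate` sends each point to the other end of its arc, and
planarity says that no two arcs have interleaving end points on the boundary. -/
@[ext]
structure TLDiagram (s n : ℕ) where
  mate : Fin s ⊕ Fin n → Fin s ⊕ Fin n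
  mate_mate : ∀ x, mate (mate x) = x
  mate_ne : ∀ x, mate x ≠ x
  planar : ∀ x y, ¬ (boundaryPos s n x < boundaryPos s n y ∧
    boundaryPos s n y < boundaryPos s n (mate x) ∧
    boundaryPos s n (mate x) < boundaryPos s n (mate y))

namespace TLDiagram

/-- A diagram from `s` to `n` is monic if every bottom point is joined to a top point. -/
def IsMonic {s n : ℕ} (D : TLDiagram s n) : Prop :=
  ∀ i : Fin s, ∃ j : Fin n, D.mate (Sum.inl i) = Sum.inr j

theorem boundaryPos_swap {s n : ℕ} (x : Fin n ⊕ Fin s) :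
    boundaryPos n s x + boundaryPos s n x.swap + 1 = s + n := by
  rcases x with i | j
  · have := i.2
    simp only [boundaryPos, Sum.swap_inl]
    omega
  · have := j.2
    simp only [boundaryPos, Sum.swap_inr]
    omega

/-- The reflection `D^*` of a diagram in a horizontal line. -/
def star {s n : ℕ} (D : TLDiagram s n) : TLDiagram n s where
  mate x := (D.mate x.swap).swap
  mate_mate x := by simp [D.mate_mate]
  mate_ne x h := D.mate_ne x.swap (by
    rw [← Sum.swap_swap (D.mate x.swap), h])
  planar x y := by
    have h := D.planar (D.mate y.swap) (D.mate x.swap)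
    rw [D.mate_mate, D.mate_mate] at h
    have h1 := boundaryPos_swap x
    have h2 := boundaryPos_swap y
    have h3 := boundaryPos_swap (D.mate x.swap).swap
    have h4 := boundaryPos_swap (D.mate y.swap).swap
    rw [Sum.swap_swap] at h3 h4
    omega

/-- The picture obtained by placing `E : s → n` on top of `D : r → s` and identifying the top
points of `D` with the bottom points of `E`. Its vertices are the `r` bottom points (`Sum.inl`),
the `s` middle points (`Sum.inr ∘ Sum.inl`) and the `n` top points (`Sum.inr ∘ Sum.inr`), and its
edges are the arcs of `D` and the arcs of `E`. -/
def stack {r s n : ℕ} (E : TLDiagram s n) (D : TLDiagram r s) :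
    SimpleGraph (Fin r ⊕ (Fin s ⊕ Fin n)) :=
  SimpleGraph.fromRel fun u v =>
    (∃ x : Fin r ⊕ Fin s, u = Sum.map id Sum.inl x ∧ v = Sum.map id Sum.inl (D.mate x)) ∨
    (∃ x : Fin s ⊕ Fin n, u = Sum.inr x ∧ v = Sum.inr (E.mate x))

/-- The number of closed loops in the picture `stack E D`: the connected components
which consist of middle points only. -/
noncomputable def loops {r s n : ℕ} (E : TLDiagram s n) (D : TLDiagram r s) : ℕ :=
  Nat.card {c : (stack E D).ConnectedComponent //
    ∀ v, (stack E D).connectedComponentMk v = c → ∃ j : Fin s, v = Sum.inr (Sum.inl j)}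

/-- The product `E D` (a power of the loop parameter times a diagram `r → n`, two outer points of
which are joined if they are connected in `stack E D`) is a multiple of a monic diagram. -/
def ProductIsMonic {r s n : ℕ} (E : TLDiagram s n) (D : TLDiagram r s) : Prop :=
  ∀ i : Fin r, ∃ j : Fin n, (stack E D).Reachable (Sum.inl i) (Sum.inr (Sum.inr j))

end TLDiagram

/-- The monic Temperley-Lieb diagrams from `t` to `n`. -/
abbrev MonicTLDiagram (t n : ℕ) : Type := {D : TLDiagram t n // D.IsMonic}

/-- The cell module `W_t(n)` as a complex vector space: it has the monic diagrams
from `t` to `n` as a basis. -/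
abbrev CellModule (t n : ℕ) : Type := MonicTLDiagram t n →₀ ℂ

open Classical in
/-- The value `(D₁, D₂)` of the invariant form on two monic diagrams. A closed loop is replaced by
the factor `-(q + q⁻¹)`. If `D₁^* D₂ : t → t` is monic, then it is a multiple of the identity
diagram, and `(D₁, D₂)` is this multiple; otherwise `(D₁, D₂) = 0`. -/
noncomputable def diagramForm (q : ℂ) {t n : ℕ} (D₁ D₂ : MonicTLDiagram t n) : ℂ :=
  if TLDiagram.ProductIsMonic D₁.1.star D₂.1 then
    (-(q + q⁻¹)) ^ TLDiagram.loops D₁.1.star D₂.1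
  else 0

/-- The invariant bilinear form on the cell module `W_t(n)`. -/
noncomputable def cellForm (q : ℂ) (t n : ℕ) : CellModule t n →ₗ[ℂ] CellModule t n →ₗ[ℂ] ℂ :=
  Finsupp.linearCombination ℂ fun D₁ : MonicTLDiagram t n =>
    Finsupp.linearCombination ℂ fun D₂ : MonicTLDiagram t n => diagramForm q D₁ D₂

/-- The radical `Rad_t` of the invariant form: all `v` with `(v, w) = 0` for every `w`. -/
noncomputable def cellRadical (q : ℂ) (t n : ℕ) : Submodule ℂ (CellModule t n) :=
  LinearMap.ker (cellForm q t n)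

/-- The module `L_t(n) = W_t(n) / Rad_t` as a complex vector space. -/
abbrev SimpleTLModule (q : ℂ) (t n : ℕ) : Type := CellModule t n ⧸ cellRadical q t n

/-- `W_t(x) = ∑ k, dim W_t(t + 2k) x^k`. -/
noncomputable def cellSeries (t : ℕ) : ℚ⟦X⟧ :=
  PowerSeries.mk fun k => (Module.finrank ℂ (CellModule t (t + 2 * k)) : ℚ)

/-- `L_t(x) = ∑ k, dim L_t(t + 2k) x^k`. -/
noncomputable def simpleSeries (q : ℂ) (t : ℕ) : ℚ⟦X⟧ :=
  PowerSeries.mk fun k => (Module.finrank ℂ (SimpleTLModule q t (t + 2 * k)) : ℚ)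

/-- The Catalan series `c(x) = ∑ n, (1 / (n + 1)) * binom(2n, n) * x^n`. -/
noncomputable def catalanC : ℚ⟦X⟧ :=
  PowerSeries.mk fun n => (1 / ((n : ℚ) + 1)) * (Nat.choose (2 * n) n : ℚ)

/-- `d(x) = c(x) - 1`. -/
noncomputable def catalanD : ℚ⟦X⟧ := catalanC - 1

/-! The dimension of L_t(n) is the rank of the Gram matrix of the form (`finrank_simpleTLModule`).
To make this matrix computable, a monic diagram acts as an operator on tensor powers of ℂ² that
commutes with the quantum sl₂ operators K, F and the transpose E of F. If A² = -q, a cup with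
weights A, A⁻¹ is invariant and a closed loop has the value A² + A⁻² = -(q + q⁻¹). The form of two
diagrams is then the standard pairing of their values `vec` on the highest weight vector
(`diagramForm_equivMonic`). This is proved by a state sum: rewiring one diagram at a shortest arc on
which it differs from the other multiplies both sides by the loop value, until the diagrams agree
(`stateSum_eq_diagramForm`).

A diagram t+1 → n+1 is `up D` with D : t → n, or `down D` with D : t+2 → n, according to the strand
at the last top point. If [t+2] ≠ 0, subtracting a combination of `up` vectors from `vec (down D)`
leaves the vector `orthVec`, built from F applied to `vec D`. It is orthogonal to all `up` vectors,
and the pairings of these vectors are -[t+3]/[t+2] times those of the `vec D`. So the Gram matrix is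
congruent to a block diagonal one (`gram_succ_succ`), which gives a recursion for ranks: the second
block disappears exactly when [t+3] = 0, that is, when ℓ ∣ t+3.

The recursion is not available when ℓ ∣ t+2, but there the form on W_{t+1} is nondegenerate. Indeed,
for parameters near q the same congruence gives a recursion for determinants. It accumulates, up to
sign, the ratios [t+1+i]/[i] with exponent dim W_{t+2i}(n), i ≥ 1. At q each [m] with m > 0 has a
simple zero if ℓ ∣ m and no zero otherwise, so for ℓ ∣ t+1 zeros and poles cancel and the
determinant is nonzero at q (`rank_formMatrix_of_dvd`).

In generating functions, W_{t+1} = W_t + x W_{t+2} is solved by c^{t+1} because c = 1 + x c². The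
L_t satisfy the same recursion with x L_{t+2} dropped if ℓ ∣ t+3, and L_t = W_t if ℓ ∣ t+1. The
closed forms satisfy these relations by x c² = d, and a solution is unique (`eq_of_recursion`). -/

/-- Monic Temperley-Lieb diagrams from `t` to `n`, generated from the empty diagram by adding a
through strand on the right (`up`) and by bending the last through strand up (`down`). -/
inductive HalfDiagram : ℕ → ℕ → Type
  | nil : HalfDiagram 0 0
  | up {t n : ℕ} : HalfDiagram t n → HalfDiagram (t + 1) (n + 1)
  | down {t n : ℕ} : HalfDiagram (t + 1) n → HalfDiagram t (n + 1)

/-! ### Quantum sl₂ on tensor powers of ℂ² -/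

/-- Vectors in tensor powers of `ℂ²`: coefficient functions on words of spins, the head of a word
being the rightmost tensor factor. -/
abbrev SpinVec : Type := List Bool → ℂ

namespace SpinVec

/-- The elementary tensor with the basis vector `s` in the rightmost position. -/
def tensor (s : Bool) (g : SpinVec) : SpinVec
  | [] => 0
  | r :: τ => if r = s then g τ else 0

/-- The restriction of a vector to words with head `s`. -/
def slice (g : SpinVec) (s : Bool) : SpinVec := fun τ => g (s :: τ)

@[simp] theorem slice_tensor (s r : Bool) (g : SpinVec) :
    slice (tensor s g) r = if r = s then g else 0 := by
  ext τ
  by_cases h : r = s <;> simp [slice, tensor, h]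

@[simp] theorem slice_add (f g : SpinVec) (s : Bool) : slice (f + g) s = slice f s + slice g s := rfl

@[simp] theorem slice_smul (c : ℂ) (g : SpinVec) (s : Bool) : slice (c • g) s = c • slice g s := rfl

@[simp] theorem slice_zero (s : Bool) : slice 0 s = 0 := rfl

theorem tensor_add (s : Bool) (f g : SpinVec) : tensor s (f + g) = tensor s f + tensor s g := by
  ext τ
  cases τ with
  | nil => simp [tensor]
  | cons r τ => by_cases h : r = s <;> simp [tensor, h]

theorem tensor_smul (s : Bool) (c : ℂ) (g : SpinVec) : tensor s (c • g) = c • tensor s g := by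
  ext τ
  cases τ with
  | nil => simp [tensor]
  | cons r τ => by_cases h : r = s <;> simp [tensor, h]

/-- The action of `K` on a basis vector. -/
noncomputable def weightK (q : ℂ) : List Bool → ℂ
  | [] => 1
  | s :: τ => (if s then q else q⁻¹) * weightK q τ

/-- The action of the lowering operator `F`. -/
noncomputable def lower (q : ℂ) : SpinVec → SpinVec
  | _, [] => 0
  | g, s :: τ => (if s then 0 else weightK q τ * g (true :: τ)) + lower q (fun ρ => g (s :: ρ)) τ

/-- The transpose of the lowering operator. -/
noncomputable def raise (q : ℂ) : SpinVec → SpinVec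
  | _, [] => 0
  | g, s :: τ => (if s then weightK q τ * g (false :: τ) else 0) + raise q (fun ρ => g (s :: ρ)) τ

theorem lower_cons (q : ℂ) (g : SpinVec) (s : Bool) (τ : List Bool) :
    lower q g (s :: τ) = (if s then 0 else weightK q τ * g (true :: τ)) + lower q (slice g s) τ := by
  rw [lower]; rfl

theorem raise_cons (q : ℂ) (g : SpinVec) (s : Bool) (τ : List Bool) :
    raise q g (s :: τ) = (if s then weightK q τ * g (false :: τ) else 0) + raise q (slice g s) τ := by
  rw [raise]; rfl

theorem lower_smul (q c : ℂ) (g : SpinVec) : lower q (c • g) = c • lower q g := by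
  ext τ
  induction τ generalizing g with
  | nil => simp [lower]
  | cons s τ ih =>
    simp only [lower_cons, slice_smul, Pi.smul_apply, smul_eq_mul, ih]
    split_ifs <;> ring

theorem raise_add (q : ℂ) (f g : SpinVec) : raise q (f + g) = raise q f + raise q g := by
  ext τ
  induction τ generalizing f g with
  | nil => simp [raise]
  | cons s τ ih =>
    simp only [raise_cons, slice_add, Pi.add_apply, ih]
    split_ifs <;> ring

theorem raise_smul (q c : ℂ) (g : SpinVec) : raise q (c • g) = c • raise q g := by
  ext τ
  induction τ generalizing g with
  | nil => simp [raise]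
  | cons s τ ih =>
    simp only [raise_cons, slice_smul, Pi.smul_apply, smul_eq_mul, ih]
    split_ifs <;> ring

/-- This is the coproduct F ⊗ 1 + K ⊗ F, with the last tensor factor split off. Inductions on the
number of factors run through it. -/
theorem slice_lower (q : ℂ) (g : SpinVec) (s : Bool) : slice (lower q g) s =
    (if s then 0 else weightK q * slice g true) + lower q (slice g s) := by
  ext τ
  rw [slice, lower_cons]
  cases s <;> simp [slice]

theorem slice_raise (q : ℂ) (g : SpinVec) (s : Bool) : slice (raise q g) s =
    (if s then weightK q * slice g false else 0) + raise q (slice g s) := by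
  ext τ
  rw [slice, raise_cons]
  cases s <;> simp [slice]

theorem lower_zero (q : ℂ) : lower q 0 = 0 := by
  simpa using lower_smul q 0 0

theorem raise_zero (q : ℂ) : raise q 0 = 0 := by
  simpa using raise_smul q 0 0

theorem lower_tensor (q : ℂ) (s : Bool) (g : SpinVec) :
    lower q (tensor s g) =
      (if s then tensor false (weightK q * g) else 0) + tensor s (lower q g) := by
  ext τ
  cases τ with
  | nil => cases s <;> simp [lower, tensor]
  | cons r τ =>
    rw [lower_cons, slice_tensor]
    cases r <;> cases s <;> simp [tensor, lower_zero]

theorem raise_tensor (q : ℂ) (s : Bool) (g : SpinVec) :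
    raise q (tensor s g) =
      (if s then 0 else tensor true (weightK q * g)) + tensor s (raise q g) := by
  ext τ
  cases τ with
  | nil => cases s <;> simp [raise, tensor]
  | cons r τ =>
    rw [raise_cons, slice_tensor]
    cases r <;> cases s <;> simp [tensor, raise_zero]

theorem weightK_mul_tensor (q : ℂ) (s : Bool) (g : SpinVec) :
    weightK q * tensor s g = (if s then q else q⁻¹) • tensor s (weightK q * g) := by
  ext τ
  cases τ with
  | nil => simp [tensor]
  | cons r τ => by_cases h : r = s <;> simp [tensor, h, weightK, mul_assoc]

/-- The word of a tuple of spins. -/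
def word : (n : ℕ) → (Fin n → Bool) → List Bool
  | 0, _ => []
  | n + 1, σ => σ (Fin.last n) :: word n (Fin.init σ)

/-- The standard bilinear form on the `n`-th tensor power. -/
noncomputable def pairing (n : ℕ) (f g : SpinVec) : ℂ :=
  ∑ σ : Fin n → Bool, f (word n σ) * g (word n σ)

@[simp] theorem pairing_zero_size (f g : SpinVec) : pairing 0 f g = f [] * g [] := by
  simp [pairing, word]

theorem sum_word_succ (n : ℕ) (h : List Bool → ℂ) :
    ∑ σ : Fin (n + 1) → Bool, h (word (n + 1) σ) =
      ∑ σ : Fin n → Bool, h (true :: word n σ) + ∑ σ : Fin n → Bool, h (false :: word n σ) := by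
  rw [← (Fin.snocEquiv fun _ => Bool).sum_comp, Fintype.sum_prod_type, Fintype.sum_bool]
  simp [Fin.snocEquiv, word]

theorem pairing_succ (n : ℕ) (f g : SpinVec) :
    pairing (n + 1) f g =
      pairing n (slice f true) (slice g true) + pairing n (slice f false) (slice g false) := by
  simp only [pairing, slice]
  exact sum_word_succ n fun τ => f τ * g τ

theorem pairing_comm (n : ℕ) (f g : SpinVec) : pairing n f g = pairing n g f := by
  simp [pairing, mul_comm]

@[simp] theorem pairing_add_left (n : ℕ) (f g h : SpinVec) :
    pairing n (f + g) h = pairing n f h + pairing n g h := by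
  simp [pairing, add_mul, Finset.sum_add_distrib]

@[simp] theorem pairing_add_right (n : ℕ) (f g h : SpinVec) :
    pairing n h (f + g) = pairing n h f + pairing n h g := by
  simp [pairing, mul_add, Finset.sum_add_distrib]

@[simp] theorem pairing_smul_left (n : ℕ) (c : ℂ) (f g : SpinVec) :
    pairing n (c • f) g = c * pairing n f g := by
  simp [pairing, Finset.mul_sum, mul_assoc]

@[simp] theorem pairing_smul_right (n : ℕ) (c : ℂ) (f g : SpinVec) :
    pairing n f (c • g) = c * pairing n f g := by
  simp [pairing, Finset.mul_sum, mul_left_comm]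

@[simp] theorem pairing_zero_left (n : ℕ) (g : SpinVec) : pairing n 0 g = 0 := by
  simp [pairing]

@[simp] theorem pairing_zero_right (n : ℕ) (g : SpinVec) : pairing n g 0 = 0 := by
  simp [pairing]

@[simp] theorem pairing_sum_left {ι : Type*} (s : Finset ι) (n : ℕ) (f : ι → SpinVec) (g : SpinVec) :
    pairing n (∑ i ∈ s, f i) g = ∑ i ∈ s, pairing n (f i) g := by
  simp only [pairing, Finset.sum_apply, Finset.sum_mul]
  exact Finset.sum_comm

@[simp] theorem pairing_sum_right {ι : Type*} (s : Finset ι) (n : ℕ) (f : ι → SpinVec) (g : SpinVec) :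
    pairing n g (∑ i ∈ s, f i) = ∑ i ∈ s, pairing n g (f i) := by
  simp only [pairing, Finset.sum_apply, Finset.mul_sum]
  exact Finset.sum_comm

/-- Splitting off the last factor leaves only the terms with K, which is diagonal and hence its own
transpose. -/
theorem pairing_lower (q : ℂ) (n : ℕ) (f g : SpinVec) :
    pairing n f (lower q g) = pairing n (raise q f) g := by
  induction n generalizing f g with
  | zero => simp [lower, raise]
  | succ n ih =>
    have hK : pairing n (slice f false) (weightK q * slice g true) =
        pairing n (weightK q * slice f false) (slice g true) := by
      simp [pairing, mul_left_comm, mul_assoc]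
    simp only [pairing_succ, slice_lower, slice_raise, pairing_add_right, pairing_add_left, ih]
    simp only [if_true, Bool.false_eq_true, if_false, pairing_zero_right, pairing_zero_left, hK]
    ring

/-- The highest weight vector of the `t`-th tensor power. -/
noncomputable def top : ℕ → SpinVec
  | 0 => fun τ => if τ = [] then 1 else 0
  | t + 1 => tensor true (top t)

theorem weightK_mul_top (q : ℂ) (t : ℕ) : weightK q * top t = q ^ t • top t := by
  induction t with
  | zero =>
    ext τ
    cases τ <;> simp [top, weightK]
  | succ t ih =>
    rw [top, weightK_mul_tensor, ih, tensor_smul, smul_smul, pow_succ']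
    simp

theorem raise_top (q : ℂ) (t : ℕ) : raise q (top t) = 0 := by
  induction t with
  | zero =>
    have h : ∀ (τ : List Bool) (g : SpinVec), (∀ s ρ, g (s :: ρ) = 0) → raise q g τ = 0 := by
      intro τ
      induction τ with
      | nil => intro g _; rw [raise]
      | cons s τ ih => intro g hg; simp [raise_cons, hg]; exact ih _ (fun _ _ => hg _ _)
    ext τ
    exact h τ _ (by simp [top])
  | succ t ih =>
    rw [top, raise_tensor, ih]
    simpa using tensor_smul true 0 0

theorem lower_top_zero (q : ℂ) : lower q (top 0) = 0 := by
  have h : ∀ (τ : List Bool) (g : SpinVec), (∀ s ρ, g (s :: ρ) = 0) → lower q g τ = 0 := by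
    intro τ
    induction τ with
    | nil => intro g _; rw [lower]
    | cons s τ ih => intro g hg; simp [lower_cons, hg]; exact ih _ (fun _ _ => hg _ _)
  ext τ
  exact h τ _ (by simp [top])

theorem lower_top_succ (q : ℂ) (t : ℕ) :
    lower q (top (t + 1)) = q ^ t • tensor false (top t) + tensor true (lower q (top t)) := by
  rw [top, lower_tensor, weightK_mul_top, tensor_smul]
  simp

/-- The quantum integer `[m]`. -/
noncomputable def qInt (q : ℂ) : ℕ → ℂ
  | 0 => 0
  | m + 1 => q⁻¹ * qInt q m + q ^ m

/-- The closed form of [m], cleared of its denominator; the zeros of [m] and their multiplicity are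
read off from it. -/
theorem qInt_mul (q : ℂ) (m : ℕ) : qInt q m * (q - q⁻¹) = q ^ m - (q⁻¹) ^ m := by
  induction m with
  | zero => simp [qInt]
  | succ m ih =>
    have : qInt q (m + 1) * (q - q⁻¹) = q⁻¹ * (qInt q m * (q - q⁻¹)) + q ^ m * (q - q⁻¹) := by
      rw [qInt]; ring
    rw [this, ih, pow_succ, pow_succ]
    ring

theorem qInt_succ' (q : ℂ) (hq : q ≠ 0) (m : ℕ) :
    q * qInt q (m + 1) = qInt q m + q ^ (m + 1) := by
  rw [qInt, pow_succ]; field_simp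

/-- With one more factor, F and then E on the last factor contribute the square of K, namely
q^(2(t+1)), and EF on the other factors contributes the previous value; the cross terms vanish. The
recursion of [m] adds these up. -/
theorem raise_lower_top (q : ℂ) (hq : q ≠ 0) (t : ℕ) :
    raise q (lower q (top (t + 1))) = (q ^ t * qInt q (t + 1)) • top (t + 1) := by
  induction t with
  | zero =>
    rw [lower_top_succ, lower_top_zero, raise_add, raise_smul, raise_tensor, raise_tensor,
      raise_top, raise_zero, weightK_mul_top]
    have h0 (s) : tensor s 0 = 0 := by simpa using tensor_smul s 0 0
    simp [h0, top, qInt]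
  | succ t ih =>
    rw [lower_top_succ, raise_add, raise_smul, raise_tensor, raise_tensor,
      raise_top, ih, weightK_mul_top]
    have h0 (s) : tensor s 0 = 0 := by simpa using tensor_smul s 0 0
    simp only [h0, tensor_smul, smul_smul, ite_true, Bool.false_eq_true, ite_false, add_zero, zero_add]
    rw [show tensor true (top (t + 1)) = top (t + 1 + 1) from rfl, ← add_smul]
    congr 1
    rw [qInt.eq_2 q (t + 1), mul_add, pow_succ]
    field_simp
    ring

/-- The weight of the left end of an arc. -/
noncomputable def arcWeight (A : ℂ) (s : Bool) : ℂ := if s then A else A⁻¹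

/-- A cup to the right of the vector `g`. -/
noncomputable def cup (A : ℂ) (g : SpinVec) : SpinVec :=
  A • tensor true (tensor false g) + A⁻¹ • tensor false (tensor true g)

theorem slice_cup (A : ℂ) (g : SpinVec) (s : Bool) :
    slice (cup A g) s = arcWeight A s • tensor (!s) g := by
  cases s <;> simp [cup, arcWeight]

end SpinVec

open SpinVec

/-! ### Diagrams as operators commuting with quantum sl₂ -/

namespace HalfDiagram

/-- The action of a diagram from `t` to `n` as a linear map from the `t`-th to the `n`-th
tensor power. -/
noncomputable def act (A : ℂ) : {t n : ℕ} → HalfDiagram t n → SpinVec → SpinVec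
  | _, _, nil, g => g
  | _, _, up D, g => fun τ => match τ with
    | [] => 0
    | s :: τ => act A D (slice g s) τ
  | _, _, down D, g => fun τ => match τ with
    | [] => 0
    | s :: τ => arcWeight A s * act A D (tensor (!s) g) τ

@[simp] theorem slice_act_up (A : ℂ) {t n : ℕ} (D : HalfDiagram t n) (g : SpinVec) (s : Bool) :
    slice (act A D.up g) s = act A D (slice g s) := by
  ext τ
  simp only [slice, act]

@[simp] theorem slice_act_down (A : ℂ) {t n : ℕ} (D : HalfDiagram (t + 1) n) (g : SpinVec)
    (s : Bool) : slice (act A D.down g) s = arcWeight A s • act A D (tensor (!s) g) := by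
  ext τ
  simp [slice, act]

theorem _root_.SpinVec.ext_slice {f g : SpinVec} (h0 : f [] = g [])
    (h : ∀ s, slice f s = slice g s) : f = g := by
  ext τ
  cases τ with
  | nil => exact h0
  | cons s τ => exact congrFun (h s) τ

theorem act_add (A : ℂ) {t n : ℕ} (D : HalfDiagram t n) (f g : SpinVec) :
    act A D (f + g) = act A D f + act A D g := by
  induction D generalizing f g with
  | nil => rfl
  | up D ih => refine ext_slice (by simp [act]) fun s => by simp [ih]
  | down D ih => refine ext_slice (by simp [act]) fun s => by simp [ih, tensor_add]

theorem act_smul (A : ℂ) {t n : ℕ} (D : HalfDiagram t n) (c : ℂ) (g : SpinVec) :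
    act A D (c • g) = c • act A D g := by
  induction D generalizing g with
  | nil => rfl
  | up D ih => refine ext_slice (by simp [act]) fun s => by simp [ih]
  | down D ih =>
    refine ext_slice (by simp [act]) fun s => by
      simp only [slice_act_down, tensor_smul, ih, slice_smul, smul_comm c]

theorem act_zero (A : ℂ) {t n : ℕ} (D : HalfDiagram t n) : act A D 0 = 0 := by
  simpa using act_smul A D 0 0

/-- The action of a diagram as a linear map. -/
noncomputable def actHom (A : ℂ) {t n : ℕ} (D : HalfDiagram t n) : SpinVec →ₗ[ℂ] SpinVec where
  toFun := act A D
  map_add' := act_add A D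
  map_smul' := act_smul A D

/-- A cup joins opposite spins, on which K acts by q · q⁻¹ = 1. -/
theorem weightK_mul_act {A q : ℂ} (hq : q ≠ 0) {t n : ℕ}
    (D : HalfDiagram t n) (g : SpinVec) : weightK q * act A D g = act A D (weightK q * g) := by
  have hs (f : SpinVec) (s : Bool) :
      slice (weightK q * f) s = (if s then q else q⁻¹) • (weightK q * slice f s) := by
    ext τ; simp [slice, weightK, mul_assoc]
  induction D generalizing g with
  | nil => rfl
  | up D ih => refine ext_slice (by simp [act]) fun s => by simp only [hs, slice_act_up, ih, act_smul]
  | down D ih =>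
    refine ext_slice (by simp [act]) fun s => ?_
    simp only [hs, slice_act_down, mul_smul_comm, ih, weightK_mul_tensor, act_smul, smul_smul]
    congr 1
    cases s <;> simp [hq, mul_comm]

/-- Only a bent strand needs an argument: F kills the cup. Its actions on the two ends of the cup
contribute A q⁻¹ and A⁻¹, which cancel because A² = -q. -/
theorem lower_act {A q : ℂ} (hA : A ^ 2 = -q) (hq : q ≠ 0) {t n : ℕ}
    (D : HalfDiagram t n) (g : SpinVec) : lower q (act A D g) = act A D (lower q g) := by
  have hA0 : A ≠ 0 := by rintro rfl; simp at hA; exact hq hA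
  induction D generalizing g with
  | nil => rfl
  | up D ih =>
    refine ext_slice (by simp [act, lower]) fun s => ?_
    cases s <;> simp [slice_lower, ih, act_add, weightK_mul_act hq]
  | down D ih =>
    refine ext_slice (by simp [act, lower]) fun s => ?_
    cases s
    · simp only [slice_lower, slice_act_down, lower_smul, ih, lower_tensor, act_add,
        mul_smul_comm, weightK_mul_act hq, weightK_mul_tensor, act_smul, smul_smul]
      simp only [arcWeight, Bool.not_true, Bool.not_false, if_true, Bool.false_eq_true, if_false,
        smul_add, ← add_assoc, ← add_smul]
      rw [show A * q⁻¹ + A⁻¹ = 0 by field_simp; rw [hA]; ring]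
      simp
    · simp only [slice_lower, slice_act_down, lower_smul, ih, lower_tensor, act_add]
      simp [act_zero]

theorem raise_act {A q : ℂ} (hA : A ^ 2 = -q) (hq : q ≠ 0) {t n : ℕ}
    (D : HalfDiagram t n) (g : SpinVec) : raise q (act A D g) = act A D (raise q g) := by
  have hA0 : A ≠ 0 := by rintro rfl; simp at hA; exact hq hA
  induction D generalizing g with
  | nil => rfl
  | up D ih =>
    refine ext_slice (by simp [act, raise]) fun s => ?_
    cases s <;> simp [slice_raise, ih, act_add, weightK_mul_act hq]
  | down D ih =>
    refine ext_slice (by simp [act, raise]) fun s => ?_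
    cases s
    · simp only [slice_raise, slice_act_down, raise_smul, ih, raise_tensor, act_add]
      simp [act_zero]
    · simp only [slice_raise, slice_act_down, raise_smul, ih, raise_tensor, act_add,
        mul_smul_comm, weightK_mul_act hq, weightK_mul_tensor, act_smul, smul_smul]
      simp only [arcWeight, Bool.not_true, Bool.not_false, if_true, Bool.false_eq_true, if_false,
        smul_add, ← add_assoc, ← add_smul]
      rw [show A⁻¹ * q + A = 0 by field_simp; rw [hA]; ring]
      simp

/-- The vector of a diagram: its value on the highest weight vector. -/
noncomputable def vec (A : ℂ) {t n : ℕ} (D : HalfDiagram t n) : SpinVec := act A D (top t)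

theorem vec_up (A : ℂ) {t n : ℕ} (D : HalfDiagram t n) : vec A D.up = tensor true (vec A D) := by
  refine ext_slice (by simp [vec, act, tensor]) fun s => ?_
  cases s <;> simp [vec, top, act_zero]

theorem vec_down (A : ℂ) {t n : ℕ} (D : HalfDiagram (t + 1) n) :
    vec A D.down = A • tensor true (act A D (tensor false (top t))) +
      A⁻¹ • tensor false (vec A D) := by
  refine ext_slice (by simp [vec, act, tensor]) fun s => ?_
  cases s <;> simp [vec, top, arcWeight]

/-- The elementary tensor by a word of spins. -/
def tensorWord : List Bool → SpinVec → SpinVec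
  | [], g => g
  | s :: ρ, g => tensor s (tensorWord ρ g)

/-- A cup below two adjacent bottom points of a diagram gives a diagram with two fewer bottom
points. If it meets a last through strand, that strand is bent: `up D` becomes `down D`. Otherwise
the cup is passed on to the smaller diagram. -/
theorem exists_act_cup (A : ℂ) {t' n : ℕ} (D : HalfDiagram t' n) (i t : ℕ) (ht : t' = t + 2)
    (hi : i ≤ t) : ∃ D' : HalfDiagram t n, ∀ ρ : List Bool, ρ.length = i → ∀ g,
      act A D (tensorWord ρ (cup A g)) = act A D' (tensorWord ρ g) := by
  induction D generalizing i t with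
  | nil => omega
  | @up s n D ih =>
    cases i with
    | zero =>
      obtain rfl : s = t + 1 := by omega
      refine ⟨down D, fun ρ hρ g => ?_⟩
      obtain rfl := List.length_eq_zero_iff.1 hρ
      refine ext_slice (by simp [act]) fun s => ?_
      simp [tensorWord, slice_cup, act_smul]
    | succ i =>
      obtain ⟨t, rfl⟩ : ∃ u, t = u + 1 := ⟨t - 1, by omega⟩
      obtain ⟨D', hD'⟩ := ih i t (by omega) (by omega)
      refine ⟨up D', fun ρ hρ g => ?_⟩
      obtain ⟨r, ρ, rfl⟩ := List.exists_cons_of_length_eq_add_one hρ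
      refine ext_slice (by simp [act]) fun s => ?_
      by_cases h : s = r
      · simp [tensorWord, h, hD' ρ (by simpa using hρ)]
      · simp [tensorWord, h, act_zero]
  | @down s n D ih =>
    obtain ⟨D', hD'⟩ := ih (i + 1) (t + 1) (by omega) (by omega)
    refine ⟨down D', fun ρ hρ g => ?_⟩
    refine ext_slice (by simp [act]) fun s => ?_
    have := hD' ((!s) :: ρ) (by simpa using hρ) g
    simp only [tensorWord] at this
    simp [this]

theorem tensorWord_replicate_top (i t : ℕ) :
    tensorWord (List.replicate i true) (top t) = top (t + i) := by
  induction i with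
  | zero => rfl
  | succ i ih => simp [List.replicate_succ, tensorWord, ih]; rfl

/-- The span of the tensors in `top` vectors with one cup inserted. -/
noncomputable def cupSpan (A : ℂ) (t : ℕ) : Submodule ℂ SpinVec :=
  Submodule.span ℂ {v | ∃ i j, t = j + i + 2 ∧
    v = tensorWord (List.replicate i true) (cup A (top j))}

theorem tensor_true_mem_cupSpan {A : ℂ} {t : ℕ} {v : SpinVec} (hv : v ∈ cupSpan A t) :
    tensor true v ∈ cupSpan A (t + 1) := by
  induction hv using Submodule.span_induction with
  | mem v hv =>
    obtain ⟨i, j, rfl, rfl⟩ := hv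
    exact Submodule.subset_span ⟨i + 1, j, by omega, rfl⟩
  | zero => rw [show tensor true 0 = 0 by simpa using tensor_smul true 0 0]; exact zero_mem _
  | add v w _ _ hv hw => rw [tensor_add]; exact add_mem hv hw
  | smul c v _ hv => rw [tensor_smul]; exact Submodule.smul_mem _ c hv

/-- Modulo cups, a lowered spin moves one place to the right at the cost of -A⁻² = q⁻¹. Moving all
terms of F on the top vector to the last place gives a geometric sum, which is [t+1]. -/
theorem lower_top_sub_mem {A q : ℂ} (hA : A ^ 2 = -q) (hq : q ≠ 0) (t : ℕ) :
    lower q (top (t + 1)) - qInt q (t + 1) • tensor false (top t) ∈ cupSpan A (t + 1) := by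
  have hA0 : A ≠ 0 := by rintro rfl; simp at hA; exact hq hA
  induction t with
  | zero =>
    have h0 : tensor true 0 = 0 := by simpa using tensor_smul true 0 0
    rw [lower_top_succ, lower_top_zero, h0]
    simp [qInt]
  | succ t ih =>
    have h1 := tensor_true_mem_cupSpan ih
    have h2 : cup A (top t) ∈ cupSpan A (t + 2) := Submodule.subset_span ⟨0, t, by omega, rfl⟩
    -- The multiple of the cup is chosen so that its A-term cancels the term with coefficient [t+1]
    -- that the induction hypothesis leaves in the second last place.
    have h3 := add_mem h1 (Submodule.smul_mem _ (qInt q (t + 1) * A⁻¹) h2)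
    convert h3 using 1
    rw [lower_top_succ, sub_eq_add_neg (lower q (top (t + 1))), tensor_add, ← neg_smul,
      tensor_smul, cup, show top (t + 1) = tensor true (top t) from rfl, qInt.eq_2 q (t + 1)]
    have hAq : A⁻¹ * A⁻¹ = -q⁻¹ := by
      field_simp; rw [hA]; simp
    ext τ
    simp only [Pi.add_apply, Pi.sub_apply, Pi.smul_apply, smul_eq_mul, ]
    generalize tensor true (tensor false (top t)) τ = x
    generalize tensor false (tensor true (top t)) τ = y
    linear_combination (-(qInt q (t + 1)) * y) * hAq - qInt q (t + 1) * x * inv_mul_cancel₀ hA0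

theorem act_cupSpan_mem {A : ℂ} {t n : ℕ} (D : HalfDiagram (t + 2) n) {v : SpinVec}
    (hv : v ∈ cupSpan A (t + 2)) :
    act A D v ∈ Submodule.span ℂ (Set.range fun D' : HalfDiagram t n => vec A D') := by
  have : Submodule.map (actHom A D) (cupSpan A (t + 2)) ≤
      Submodule.span ℂ (Set.range fun D' : HalfDiagram t n => vec A D') := by
    rw [cupSpan, Submodule.map_span_le]
    rintro _ ⟨i, j, hij, rfl⟩
    obtain ⟨D', hD'⟩ := exists_act_cup A D i t rfl (by omega)
    apply Submodule.subset_span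
    refine ⟨D', ?_⟩
    have := hD' (List.replicate i true) (by simp) (top j)
    simp only [actHom, LinearMap.coe_mk, AddHom.coe_mk, this, vec, tensorWord_replicate_top]
    congr 2
    omega
  exact this ⟨v, hv, rfl⟩

/-- The diagram commutes with F and turns the cups, by which F on the top vector differs from a
multiple of one tensor, into diagrams with two fewer through strands. -/
theorem lower_vec_sub_mem {A q : ℂ} (hA : A ^ 2 = -q) (hq : q ≠ 0) {t n : ℕ}
    (D : HalfDiagram (t + 2) n) :
    lower q (vec A D) - qInt q (t + 2) • act A D (tensor false (top (t + 1))) ∈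
      Submodule.span ℂ (Set.range fun D' : HalfDiagram t n => vec A D') := by
  have h := act_cupSpan_mem D (lower_top_sub_mem hA hq (t + 1))
  rwa [sub_eq_add_neg, ← neg_smul, act_add, act_smul, neg_smul, ← sub_eq_add_neg,
    ← lower_act hA hq] at h

theorem lower_vec_one {A q : ℂ} (hA : A ^ 2 = -q) (hq : q ≠ 0) {n : ℕ} (D : HalfDiagram 1 n) :
    lower q (vec A D) = act A D (tensor false (top 0)) := by
  have h0 : tensor true 0 = 0 := by simpa using tensor_smul true 0 0
  rw [vec, lower_act hA hq, lower_top_succ, lower_top_zero, h0]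
  simp

theorem pairing_lower_vec {A q : ℂ} (hA : A ^ 2 = -q) (hq : q ≠ 0) {t n : ℕ}
    (D D' : HalfDiagram (t + 1) n) :
    pairing n (lower q (vec A D)) (lower q (vec A D')) =
      q ^ t * qInt q (t + 1) * pairing n (vec A D) (vec A D') := by
  rw [pairing_lower, vec, lower_act hA hq, raise_act hA hq, raise_lower_top q hq, act_smul,
    pairing_smul_left]

/-- The vectors of diagrams are highest weight vectors: E, the transpose of F, kills them. -/
theorem pairing_vec_lower_vec {A q : ℂ} (hA : A ^ 2 = -q) (hq : q ≠ 0) {t s n : ℕ}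
    (D : HalfDiagram t n) (D' : HalfDiagram s n) :
    pairing n (vec A D) (lower q (vec A D')) = 0 := by
  rw [pairing_lower, vec, raise_act hA hq, raise_top, act_zero, pairing_zero_left]

/-! ### Orthogonal splitting at the last tensor factor -/

/-- The component of `vec (down D)` orthogonal to the vectors of diagrams `up D'`. -/
noncomputable def orthVec (A q : ℂ) {t n : ℕ} (D : HalfDiagram (t + 1) n) : SpinVec :=
  (A * (qInt q (t + 1))⁻¹) • tensor true (lower q (vec A D)) + A⁻¹ • tensor false (vec A D)

theorem pairing_up_orthVec {A q : ℂ} (hA : A ^ 2 = -q) (hq : q ≠ 0) {t s n : ℕ}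
    (D : HalfDiagram s n) (D' : HalfDiagram (t + 1) n) :
    pairing (n + 1) (vec A D.up) (orthVec A q D') = 0 := by
  simp [pairing_succ, orthVec, vec_up, pairing_vec_lower_vec hA hq]

/-- The slices at the two spins contribute A² q^t / [t+1] and A⁻². With A² = -q the sum is -(q^(t+1)
+ q⁻¹[t+1]) / [t+1], whose numerator is the recursion for [t+2]. -/
theorem pairing_orthVec {A q : ℂ} (hA : A ^ 2 = -q) (hq : q ≠ 0) {t n : ℕ}
    (ht : qInt q (t + 1) ≠ 0) (D D' : HalfDiagram (t + 1) n) :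
    pairing (n + 1) (orthVec A q D) (orthVec A q D') =
      (-(qInt q (t + 2) / qInt q (t + 1))) * pairing n (vec A D) (vec A D') := by
  have hA0 : A ≠ 0 := by rintro rfl; simp at hA; exact hq hA
  have hAq : A⁻¹ * A⁻¹ = -q⁻¹ := by
    field_simp; rw [hA]; simp
  have h2 := qInt_succ' q hq (t + 1)
  simp only [pairing_succ, orthVec, slice_add, slice_smul, slice_tensor, if_true,
    Bool.true_eq_false, Bool.false_eq_true, if_false, smul_zero, add_zero, zero_add,
    pairing_smul_left, pairing_smul_right, pairing_lower_vec hA hq]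
  have e1 : A * (qInt q (t + 1))⁻¹ * (A * (qInt q (t + 1))⁻¹ * (q ^ t * qInt q (t + 1) *
      pairing n (vec A D) (vec A D'))) =
      A ^ 2 * q ^ t * (qInt q (t + 1))⁻¹ * pairing n (vec A D) (vec A D') := by
    field_simp
  rw [e1, ← mul_assoc A⁻¹, hAq, hA, show qInt q (t + 2) = q⁻¹ * (qInt q (t + 1) + q ^ (t + 2)) by
    rw [show qInt q (t + 2) = q⁻¹ * (q * qInt q (t + 2)) by field_simp, h2]]
  field_simp
  ring

theorem vec_down_zero {A q : ℂ} (hA : A ^ 2 = -q) (hq : q ≠ 0) {n : ℕ} (D : HalfDiagram 1 n) :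
    vec A D.down = orthVec A q D := by
  rw [vec_down, orthVec, lower_vec_one hA hq]
  simp [qInt]

/-- The two vectors differ only in the part with last spin `true`: there `vec (down D)` has D
applied to a lowered last spin, and `orthVec` has F applied to `vec D`, divided by [t+2]. By
`lower_vec_sub_mem` this difference is a combination of vectors of diagrams t → n, and appending the
spin `true` makes them `up` vectors. -/
theorem vec_down_sub_orthVec_mem {A q : ℂ} (hA : A ^ 2 = -q) (hq : q ≠ 0) {t n : ℕ}
    (ht : qInt q (t + 2) ≠ 0) (D : HalfDiagram (t + 2) n) :
    vec A D.down - orthVec A q D ∈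
      Submodule.span ℂ (Set.range fun D' : HalfDiagram t n => vec A D'.up) := by
  have h := lower_vec_sub_mem hA hq D
  let T : SpinVec →ₗ[ℂ] SpinVec :=
    { toFun := tensor true, map_add' := tensor_add true, map_smul' := tensor_smul true }
  have h2 := Submodule.mem_map_of_mem (f := T) h
  rw [Submodule.map_span, ← Set.range_comp] at h2
  have h3 := Submodule.smul_mem _ (-(A * (qInt q (t + 2))⁻¹)) h2
  have h4 : (T ∘ fun D' : HalfDiagram t n => vec A D') = fun D' => vec A D'.up := by
    ext1 D'; simp [T, vec_up]
  rw [h4] at h3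
  convert h3 using 1
  simp only [map_sub, map_smul]
  rw [vec_down, orthVec, show ∀ v, T v = tensor true v from fun _ => rfl]
  rw [smul_sub, smul_smul, neg_mul, mul_assoc, inv_mul_cancel₀ ht]
  simp only [show ∀ v, T v = tensor true v from fun _ => rfl]
  simp only [mul_one, neg_smul]
  abel

end HalfDiagram

/-! ### Gram matrices of diagram vectors and their recursion -/

namespace HalfDiagram

/-- Diagrams `1 → n` are the diagrams `0 → n + 1`. -/
noncomputable def downEquiv (n : ℕ) : HalfDiagram 1 n ≃ HalfDiagram 0 (n + 1) :=
  Equiv.ofBijective down ⟨fun D D' h => by cases h; rfl, fun D => by cases D with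
    | down D => exact ⟨D, rfl⟩⟩

/-- Diagrams `t + 1 → n + 1` according to whether the last top point lies on a through strand. -/
noncomputable def sumEquiv (t n : ℕ) :
    HalfDiagram t n ⊕ HalfDiagram (t + 2) n ≃ HalfDiagram (t + 1) (n + 1) :=
  Equiv.ofBijective (Sum.elim up down)
    ⟨by
      rintro (D | D) (D' | D') h <;> simp only [Sum.elim_inl, Sum.elim_inr] at h <;> cases h <;> rfl,
     fun D => by
      cases D with
      | up D => exact ⟨Sum.inl D, rfl⟩
      | down D => exact ⟨Sum.inr D, rfl⟩⟩

theorem downEquiv_apply {n : ℕ} (D : HalfDiagram 1 n) : downEquiv n D = D.down := rfl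

theorem sumEquiv_inl {t n : ℕ} (D : HalfDiagram t n) : sumEquiv t n (Sum.inl D) = D.up := rfl

theorem sumEquiv_inr {t n : ℕ} (D : HalfDiagram (t + 2) n) :
    sumEquiv t n (Sum.inr D) = D.down := rfl

instance isEmpty_succ_zero (t : ℕ) : IsEmpty (HalfDiagram (t + 1) 0) := ⟨fun D => by cases D⟩

instance unique_zero : Unique (HalfDiagram 0 0) := ⟨⟨nil⟩, fun D => by cases D; rfl⟩

instance finite (t n : ℕ) : Finite (HalfDiagram t n) := by
  induction n generalizing t with
  | zero => cases t <;> infer_instance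
  | succ n ih =>
    cases t with
    | zero => exact Finite.of_equiv _ (downEquiv n)
    | succ t => exact Finite.of_equiv _ (sumEquiv t n)

noncomputable instance fintype (t n : ℕ) : Fintype (HalfDiagram t n) := Fintype.ofFinite _

noncomputable instance decEq (t n : ℕ) : DecidableEq (HalfDiagram t n) := Classical.decEq _

theorem isEmpty_of_lt {t n : ℕ} (h : n < t) : IsEmpty (HalfDiagram t n) := by
  induction n generalizing t with
  | zero => obtain ⟨t, rfl⟩ := Nat.exists_eq_add_of_lt h; exact ⟨fun D => by cases D⟩
  | succ n ih =>
    refine ⟨fun D => ?_⟩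
    cases D with
    | up D => exact (ih (by omega)).false D
    | down D => exact (ih (by omega)).false D

/-- The number of monic diagrams. -/
noncomputable def count (t n : ℕ) : ℕ := Fintype.card (HalfDiagram t n)

theorem count_zero_zero : count 0 0 = 1 := Fintype.card_unique

theorem count_of_lt {t n : ℕ} (h : n < t) : count t n = 0 :=
  haveI := isEmpty_of_lt h
  Fintype.card_eq_zero

theorem count_zero_succ (n : ℕ) : count 0 (n + 1) = count 1 n :=
  (Fintype.card_congr (downEquiv n)).symm

theorem count_succ_succ (t n : ℕ) : count (t + 1) (n + 1) = count t n + count (t + 2) n := by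
  rw [count, ← Fintype.card_congr (sumEquiv t n), Fintype.card_sum]; rfl

/-- The Gram matrix of the vectors of diagrams. -/
noncomputable def gram (A : ℂ) (t n : ℕ) : Matrix (HalfDiagram t n) (HalfDiagram t n) ℂ :=
  Matrix.of fun D D' => pairing n (vec A D) (vec A D')

theorem gram_zero_succ {A q : ℂ} (hA : A ^ 2 = -q) (hq : q ≠ 0) (n : ℕ) :
    (gram A 0 (n + 1)).submatrix (downEquiv n) (downEquiv n) =
      (-(qInt q 2 / qInt q 1)) • gram A 1 n := by
  ext D D'
  have h1 : qInt q 1 = 1 := by simp [qInt]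
  change pairing (n + 1) (vec A D.down) (vec A D'.down) = _
  rw [vec_down_zero hA hq, vec_down_zero hA hq]
  exact pairing_orthVec hA hq (t := 0) (by simp [h1]) D D'

/-- Replacing each `down` vector by its `orthVec` is a unitriangular change of basis, X being the
coefficients of the `up` vectors. In the new basis the two families are orthogonal. -/
theorem gram_succ_succ {A q : ℂ} (hA : A ^ 2 = -q) (hq : q ≠ 0) (t n : ℕ)
    (ht : qInt q (t + 2) ≠ 0) :
    ∃ X : Matrix (HalfDiagram (t + 2) n) (HalfDiagram t n) ℂ,
      (gram A (t + 1) (n + 1)).submatrix (sumEquiv t n) (sumEquiv t n) =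
        Matrix.fromBlocks 1 0 X 1 *
          Matrix.fromBlocks (gram A t n) 0 0
            ((-(qInt q (t + 3) / qInt q (t + 2))) • gram A (t + 2) n) *
          (Matrix.fromBlocks 1 0 X 1).transpose := by
  have h := fun D => (Submodule.mem_span_range_iff_exists_fun ℂ).1
    (vec_down_sub_orthVec_mem hA hq ht (t := t) (n := n) D)
  choose X hX using h
  have hX' (D) : vec A (down D) = orthVec A q D + ∑ i, X D i • vec A (up i) := by
    rw [hX]; abel
  have hup (D D' : HalfDiagram t n) :
      pairing (n + 1) (vec A (up D)) (vec A (up D')) = gram A t n D D' := by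
    simp [pairing_succ, vec_up, gram]
  have hsymm (D D' : HalfDiagram t n) : gram A t n D D' = gram A t n D' D := pairing_comm _ _ _
  have horth (D D') := pairing_up_orthVec hA hq (n := n) (s := t) (t := t + 1) D D'
  have horth' (D : HalfDiagram t n) (D' : HalfDiagram (t + 2) n) :
      pairing (n + 1) (orthVec A q D') (vec A (up D)) = 0 := by
    rw [pairing_comm]; exact horth D D'
  have ho (D D' : HalfDiagram (t + 2) n) := pairing_orthVec hA hq (t := t + 1) ht D D'
  refine ⟨Matrix.of X, ?_⟩
  rw [Matrix.fromBlocks_transpose, Matrix.fromBlocks_multiply, Matrix.fromBlocks_multiply]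
  ext (D | D) (D' | D')
  · simp [sumEquiv_inl, gram, pairing_succ, vec_up]
  · simp only [Matrix.submatrix_apply, sumEquiv_inl,
      sumEquiv_inr, gram, Matrix.of_apply, hX', pairing_add_right, pairing_sum_right,
      pairing_smul_right, horth]
    simp [Matrix.mul_apply, hup, gram, mul_comm]
  · simp only [Matrix.submatrix_apply, sumEquiv_inl,
      sumEquiv_inr, gram, Matrix.of_apply, hX', pairing_add_left, pairing_sum_left,
      pairing_smul_left, horth']
    simp [Matrix.mul_apply, hup, gram]
  · simp only [Matrix.submatrix_apply, sumEquiv_inr, gram, Matrix.of_apply, hX', pairing_add_left, pairing_sum_left,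
      pairing_smul_left, horth', pairing_add_right, pairing_sum_right, pairing_smul_right, horth,
      ho, hup]
    simp only [mul_zero, Finset.sum_const_zero, add_zero, zero_add]
    simp only [Matrix.fromBlocks_apply₂₂, Matrix.add_apply, Matrix.mul_apply, Matrix.of_apply,
      Matrix.transpose_apply, Matrix.one_mul, Matrix.mul_one, Matrix.transpose_one,
      Matrix.mul_zero, add_zero, Matrix.smul_apply, smul_eq_mul,
      Matrix.transpose_zero, zero_add, Finset.mul_sum, Finset.sum_mul]
    rw [add_comm]
    congr 1
    refine Finset.sum_congr rfl fun i _ => Finset.sum_congr rfl fun j _ => ?_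
    ring

theorem det_gram_zero_succ {A q : ℂ} (hA : A ^ 2 = -q) (hq : q ≠ 0) (n : ℕ) :
    (gram A 0 (n + 1)).det = (-(qInt q 2 / qInt q 1)) ^ count 1 n * (gram A 1 n).det := by
  rw [← Matrix.det_submatrix_equiv_self (downEquiv n), gram_zero_succ hA hq, Matrix.det_smul]
  rfl

theorem det_gram_succ_succ {A q : ℂ} (hA : A ^ 2 = -q) (hq : q ≠ 0) (t n : ℕ)
    (ht : qInt q (t + 2) ≠ 0) :
    (gram A (t + 1) (n + 1)).det = (gram A t n).det *
      ((-(qInt q (t + 3) / qInt q (t + 2))) ^ count (t + 2) n * (gram A (t + 2) n).det) := by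
  obtain ⟨X, hX⟩ := gram_succ_succ hA hq t n ht
  rw [← Matrix.det_submatrix_equiv_self (sumEquiv t n), hX, Matrix.det_mul, Matrix.det_mul,
    Matrix.det_transpose, Matrix.det_fromBlocks_zero₁₂, Matrix.det_fromBlocks_zero₁₂,
    Matrix.det_smul]
  simp [count]

theorem _root_.Matrix.rank_fromBlocks_diagonal {m n K : Type*} [Fintype m] [Fintype n]
    [Field K] (M : Matrix m m K) (N : Matrix n n K) :
    (Matrix.fromBlocks M 0 0 N).rank = M.rank + N.rank := by
  classical
  let e : (m ⊕ n → K) ≃ₗ[K] (m → K) × (n → K) := LinearEquiv.sumArrowLequivProdArrow m n K K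
  have h : (Matrix.fromBlocks M 0 0 N).mulVecLin =
      e.symm.toLinearMap ∘ₗ (M.mulVecLin.prodMap N.mulVecLin) ∘ₗ e.toLinearMap := by
    refine LinearMap.ext fun x => ?_
    ext i
    simp only [Matrix.mulVecLin_apply, Matrix.fromBlocks_mulVec]
    cases i <;> simp only [Matrix.zero_mulVec, LinearEquiv.coe_coe, LinearMap.comp_apply, Sum.elim_inl, Sum.elim_inr] <;> simp [Function.comp_def] <;> rfl
  let f : ((LinearMap.range M.mulVecLin).prod (LinearMap.range N.mulVecLin)) ≃ₗ[K]
      LinearMap.range M.mulVecLin × LinearMap.range N.mulVecLin :=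
    { toFun := fun x => (⟨x.1.1, x.2.1⟩, ⟨x.1.2, x.2.2⟩)
      invFun := fun x => ⟨(x.1.1, x.2.1), ⟨x.1.2, x.2.2⟩⟩
      map_add' := fun _ _ => rfl
      map_smul' := fun _ _ => rfl
      left_inv := fun _ => rfl
      right_inv := fun _ => rfl }
  rw [Matrix.rank, h, LinearMap.range_comp, LinearEquiv.finrank_map_eq,
    LinearMap.range_comp_of_range_eq_top _ (LinearEquiv.range e), LinearMap.range_prodMap,
    f.finrank_eq, Module.finrank_prod]
  rfl

theorem rank_gram_zero_succ {A q : ℂ} (hA : A ^ 2 = -q) (hq : q ≠ 0) (n : ℕ)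
    (h2 : qInt q 2 ≠ 0) : (gram A 0 (n + 1)).rank = (gram A 1 n).rank := by
  rw [← Matrix.rank_submatrix _ (downEquiv n) (downEquiv n), gram_zero_succ hA hq,
    Matrix.rank_smul_of_mem_nonZeroDivisors]
  have h1 : qInt q 1 = 1 := by simp [qInt]
  simpa [h1] using h2

/-- The unitriangular factors do not affect the rank. The second diagonal block has the scalar
-[t+3]/[t+2], so it is either zero or keeps its full rank. -/
theorem rank_gram_succ_succ {A q : ℂ} (hA : A ^ 2 = -q) (hq : q ≠ 0) (t n : ℕ)
    (ht : qInt q (t + 2) ≠ 0) :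
    (gram A (t + 1) (n + 1)).rank = (gram A t n).rank +
      if qInt q (t + 3) = 0 then 0 else (gram A (t + 2) n).rank := by
  obtain ⟨X, hX⟩ := gram_succ_succ hA hq t n ht
  have hdet : IsUnit (Matrix.fromBlocks (1 : Matrix (HalfDiagram t n) (HalfDiagram t n) ℂ) 0 X
      1).det := by simp
  rw [← Matrix.rank_submatrix _ (sumEquiv t n) (sumEquiv t n), hX,
    Matrix.rank_mul_eq_left_of_isUnit_det _ _ (by rwa [Matrix.det_transpose]),
    Matrix.rank_mul_eq_right_of_isUnit_det _ _ hdet, Matrix.rank_fromBlocks_diagonal]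
  split_ifs with h
  · simp [h]
  · rw [Matrix.rank_smul_of_mem_nonZeroDivisors]
    simp [h, ht]

end HalfDiagram

/-! ### Adding and bending strands of planar matchings -/

namespace TLDiagram

theorem boundaryPos_injective (s n : ℕ) : Function.Injective (boundaryPos s n) := by
  rintro (i | i) (j | j) h <;> simp only [boundaryPos] at h
  · exact congrArg Sum.inl (Fin.ext h)
  · have := i.2; omega
  · have := j.2; omega
  · have := i.2; have := j.2; exact congrArg Sum.inr (Fin.ext (by omega))

theorem mate_injective {s n : ℕ} (D : TLDiagram s n) : Function.Injective D.mate :=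
  fun x y h => by rw [← D.mate_mate x, h, D.mate_mate]

/-- The boundary points of a rectangle with one more point on the right of either edge. -/
def upPoint (t n : ℕ) : (Fin t ⊕ Fin n) ⊕ Bool → Fin (t + 1) ⊕ Fin (n + 1)
  | Sum.inl (Sum.inl i) => Sum.inl i.castSucc
  | Sum.inl (Sum.inr j) => Sum.inr j.castSucc
  | Sum.inr false => Sum.inl (Fin.last t)
  | Sum.inr true => Sum.inr (Fin.last n)

/-- The two new points occupy positions t and t + 1 on the way around the boundary, so the points
behind them move by two and the order of the old points is kept. -/
theorem boundaryPos_upPoint_inl {t n : ℕ} (x : Fin t ⊕ Fin n) :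
    boundaryPos (t + 1) (n + 1) (upPoint t n (Sum.inl x)) =
      if boundaryPos t n x < t then boundaryPos t n x else boundaryPos t n x + 2 := by
  rcases x with i | j
  · simp [boundaryPos, upPoint]
  · have := j.2
    rw [if_neg (by simp [boundaryPos])]
    simp only [boundaryPos, upPoint, Fin.val_castSucc]
    omega

theorem boundaryPos_upPoint_inr {t n : ℕ} (b : Bool) :
    boundaryPos (t + 1) (n + 1) (upPoint t n (Sum.inr b)) = if b then t + 1 else t := by
  cases b <;> simp [boundaryPos, upPoint]

theorem upPoint_bijective (t n : ℕ) : Function.Bijective (upPoint t n) := by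
  constructor
  · rintro ((i | i) | (_ | _)) ((j | j) | (_ | _)) h <;>
      simp only [upPoint, Sum.inl.injEq, Sum.inr.injEq, Fin.castSucc_inj, reduceCtorEq] at h <;>
      first
        | rfl
        | exact congrArg _ (congrArg _ h)
        | exact absurd h (Fin.castSucc_lt_last _).ne
        | exact absurd h (Fin.castSucc_lt_last _).ne'
  · rintro (i | j)
    · refine Fin.lastCases ⟨Sum.inr false, rfl⟩ (fun i => ⟨Sum.inl (Sum.inl i), rfl⟩) i
    · refine Fin.lastCases ⟨Sum.inr true, rfl⟩ (fun i => ⟨Sum.inl (Sum.inr i), rfl⟩) j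

/-- `upPoint` as an equivalence. -/
noncomputable def upEquiv (t n : ℕ) : (Fin t ⊕ Fin n) ⊕ Bool ≃ Fin (t + 1) ⊕ Fin (n + 1) :=
  Equiv.ofBijective _ (upPoint_bijective t n)

theorem upEquiv_apply {t n : ℕ} (x) : upEquiv t n x = upPoint t n x := rfl

/-- Add a through strand on the right. -/
noncomputable def up {t n : ℕ} (D : TLDiagram t n) : TLDiagram (t + 1) (n + 1) where
  mate x := upEquiv t n (Sum.map D.mate not ((upEquiv t n).symm x))
  mate_mate x := by
    obtain ⟨x, rfl⟩ := (upEquiv t n).surjective x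
    rcases x with x | b <;> simp [D.mate_mate]
  mate_ne x h := by
    obtain ⟨x, rfl⟩ := (upEquiv t n).surjective x
    rw [Equiv.symm_apply_apply, EmbeddingLike.apply_eq_iff_eq] at h
    rcases x with x | b
    · exact D.mate_ne x (by simpa using h)
    · simp at h
  planar x y := by
    obtain ⟨x, rfl⟩ := (upEquiv t n).surjective x
    obtain ⟨y, rfl⟩ := (upEquiv t n).surjective y
    rw [Equiv.symm_apply_apply, Equiv.symm_apply_apply]
    rcases x with x | b <;> rcases y with y | b' <;>
      simp only [Sum.map_inl, Sum.map_inr, upEquiv_apply, boundaryPos_upPoint_inl,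
        boundaryPos_upPoint_inr]
    · have := D.planar x y
      split_ifs <;> omega
    · cases b' <;> simp <;> split_ifs <;> omega
    · cases b <;> simp <;> split_ifs <;> omega
    · cases b <;> cases b' <;> simp

theorem up_mate {t n : ℕ} (D : TLDiagram t n) (x) :
    D.up.mate (upPoint t n x) = upPoint t n (Sum.map D.mate not x) := by
  change upEquiv t n (Sum.map D.mate not ((upEquiv t n).symm (upEquiv t n x))) = _
  rw [Equiv.symm_apply_apply]
  rfl

/-- Move the last point of the bottom edge to the end of the top edge. -/
def downPoint (t n : ℕ) : Fin (t + 1) ⊕ Fin n → Fin t ⊕ Fin (n + 1)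
  | Sum.inl i => Fin.lastCases (Sum.inr (Fin.last n)) Sum.inl i
  | Sum.inr j => Sum.inr j.castSucc

@[simp] theorem downPoint_last (t n : ℕ) :
    downPoint t n (Sum.inl (Fin.last t)) = Sum.inr (Fin.last n) := by simp [downPoint]

@[simp] theorem downPoint_castSucc {t n : ℕ} (i : Fin t) :
    downPoint t n (Sum.inl i.castSucc) = Sum.inl i := by simp [downPoint]

@[simp] theorem downPoint_inr {t n : ℕ} (j : Fin n) :
    downPoint t n (Sum.inr j) = Sum.inr j.castSucc := rfl

/-- The last bottom point and the last top point are neighbours on the way around the boundary, so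
bending the strand changes no position and planarity carries over unchanged. -/
theorem boundaryPos_downPoint {t n : ℕ} (x : Fin (t + 1) ⊕ Fin n) :
    boundaryPos t (n + 1) (downPoint t n x) = boundaryPos (t + 1) n x := by
  rcases x with i | j
  · induction i using Fin.lastCases with
    | last => simp [boundaryPos]
    | cast i => simp [boundaryPos]
  · have := j.2
    simp only [boundaryPos, downPoint_inr, Fin.val_castSucc]
    omega

theorem downPoint_bijective (t n : ℕ) : Function.Bijective (downPoint t n) := by
  constructor
  · intro x y h
    apply boundaryPos_injective
    rw [← boundaryPos_downPoint, h, boundaryPos_downPoint]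
  · rintro (i | j)
    · exact ⟨Sum.inl i.castSucc, by simp⟩
    · exact Fin.lastCases ⟨Sum.inl (Fin.last t), by simp⟩ (fun j => ⟨Sum.inr j, by simp⟩) j

/-- `downPoint` as an equivalence. -/
noncomputable def downPointEquiv (t n : ℕ) : Fin (t + 1) ⊕ Fin n ≃ Fin t ⊕ Fin (n + 1) :=
  Equiv.ofBijective _ (downPoint_bijective t n)

theorem downPointEquiv_apply {t n : ℕ} (x) : downPointEquiv t n x = downPoint t n x := rfl

theorem boundaryPos_downPointEquiv_symm {t n : ℕ} (x) :
    boundaryPos (t + 1) n ((downPointEquiv t n).symm x) = boundaryPos t (n + 1) x := by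
  rw [← boundaryPos_downPoint, ← downPointEquiv_apply, Equiv.apply_symm_apply]

/-- Bend the last bottom point up. -/
noncomputable def down {t n : ℕ} (D : TLDiagram (t + 1) n) : TLDiagram t (n + 1) where
  mate x := downPointEquiv t n (D.mate ((downPointEquiv t n).symm x))
  mate_mate x := by simp [D.mate_mate]
  mate_ne x h := D.mate_ne _ ((Equiv.eq_symm_apply _).2 h)
  planar x y := by
    simp only [downPointEquiv_apply, boundaryPos_downPoint]
    have := D.planar ((downPointEquiv t n).symm x) ((downPointEquiv t n).symm y)
    simpa only [boundaryPos_downPointEquiv_symm] using this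

theorem down_mate {t n : ℕ} (D : TLDiagram (t + 1) n) (x) :
    D.down.mate (downPoint t n x) = downPoint t n (D.mate x) := by
  change downPointEquiv t n (D.mate ((downPointEquiv t n).symm (downPointEquiv t n x))) = _
  rw [Equiv.symm_apply_apply]
  rfl

/-- Bend the last top point down. -/
noncomputable def undown {t n : ℕ} (D : TLDiagram t (n + 1)) : TLDiagram (t + 1) n where
  mate x := (downPointEquiv t n).symm (D.mate (downPointEquiv t n x))
  mate_mate x := by simp [D.mate_mate]
  mate_ne x h := D.mate_ne (downPointEquiv t n x) (by rw [← Equiv.symm_apply_eq, h])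
  planar x y := by
    simp only [boundaryPos_downPointEquiv_symm]
    have := D.planar (downPointEquiv t n x) (downPointEquiv t n y)
    simpa only [downPointEquiv_apply, boundaryPos_downPoint] using this

theorem down_undown {t n : ℕ} (D : TLDiagram t (n + 1)) : D.undown.down = D := by
  ext1
  ext1 x
  simp [down, undown]

theorem undown_down {t n : ℕ} (D : TLDiagram (t + 1) n) : D.down.undown = D := by
  ext1
  ext1 x
  simp [down, undown]

theorem up_injective {t n : ℕ} : Function.Injective (up : TLDiagram t n → _) := by
  intro D D' h
  ext1
  ext1 x
  have := congrArg (fun E => E.mate (upPoint t n (Sum.inl x))) h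
  simp only [up_mate] at this
  simpa using (upPoint_bijective t n).1 this

theorem isMonic_up {t n : ℕ} {D : TLDiagram t n} : D.up.IsMonic ↔ D.IsMonic := by
  constructor
  · intro h i
    obtain ⟨j, hj⟩ := h i.castSucc
    have h2 := up_mate D (Sum.inl (Sum.inl i))
    rw [show upPoint t n (Sum.inl (Sum.inl i)) = Sum.inl i.castSucc from rfl, hj] at h2
    simp only [Sum.map_inl] at h2
    cases h3 : D.mate (Sum.inl i) with
    | inl k => rw [h3] at h2; simp [upPoint] at h2
    | inr k => exact ⟨k, rfl⟩
  · intro h i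
    induction i using Fin.lastCases with
    | last => exact ⟨Fin.last n, up_mate D (Sum.inr false)⟩
    | cast i =>
      obtain ⟨j, hj⟩ := h i
      refine ⟨j.castSucc, ?_⟩
      have := up_mate D (Sum.inl (Sum.inl i))
      rwa [Sum.map_inl, hj] at this

theorem isMonic_down {t n : ℕ} {D : TLDiagram (t + 1) n} (h : D.IsMonic) : D.down.IsMonic := by
  intro i
  obtain ⟨j, hj⟩ := h i.castSucc
  refine ⟨j.castSucc, ?_⟩
  rw [← downPoint_castSucc, down_mate, hj, downPoint_inr]

theorem isMonic_undown {t n : ℕ} {D : TLDiagram t (n + 1)} (h : D.IsMonic) {j : Fin (n + 1)}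
    (hj : D.mate (Sum.inr (Fin.last n)) = Sum.inr j) : D.undown.IsMonic := by
  rw [← D.down_undown] at h hj
  generalize D.undown = E at h hj
  have key (x) (j : Fin (n + 1)) (hx : E.down.mate (downPoint t n x) = Sum.inr j)
      (hj : j ≠ Fin.last n) : ∃ k, E.mate x = Sum.inr k := by
    rw [down_mate] at hx
    cases h3 : E.mate x with
    | inl k =>
      exfalso
      rw [h3] at hx
      induction k using Fin.lastCases with
      | last => rw [downPoint_last] at hx; exact hj (Sum.inr.inj hx).symm
      | cast k => simp at hx
    | inr k => exact ⟨k, rfl⟩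
  intro i
  induction i using Fin.lastCases with
  | last =>
    refine key _ j (by rw [downPoint_last, hj]) ?_
    rintro rfl
    exact E.down.mate_ne _ hj
  | cast i =>
    obtain ⟨k, hk⟩ := h i
    refine key _ k (by rw [downPoint_castSucc, hk]) ?_
    rintro rfl
    rw [← hk, mate_mate] at hj
    simp at hj

/-- An earlier through strand ending at the last top point would cross the last through strand. -/
theorem IsMonic.eq_last {t n : ℕ} {D : TLDiagram (t + 1) (n + 1)} (h : D.IsMonic)
    {i : Fin (t + 1)} (hi : D.mate (Sum.inr (Fin.last n)) = Sum.inl i) : i = Fin.last t := by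
  by_contra hne
  obtain ⟨j, hj⟩ := h (Fin.last t)
  have hi' : D.mate (Sum.inl i) = Sum.inr (Fin.last n) := by rw [← hi, mate_mate]
  have hjn : j ≠ Fin.last n := by
    rintro rfl
    rw [← hj, mate_mate] at hi
    exact hne (Sum.inl.inj hi).symm
  have := D.planar (Sum.inl i) (Sum.inl (Fin.last t))
  rw [hi', hj] at this
  have h1 := Fin.val_lt_last hne
  have h2 := Fin.val_lt_last hjn
  simp only [boundaryPos, Fin.val_last] at this h1 h2
  omega

theorem exists_up_eq {t n : ℕ} {D : TLDiagram (t + 1) (n + 1)}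
    (h : D.mate (Sum.inr (Fin.last n)) = Sum.inl (Fin.last t)) : ∃ E : TLDiagram t n, E.up = D := by
  have h' : D.mate (Sum.inl (Fin.last t)) = Sum.inr (Fin.last n) := by rw [← h, mate_mate]
  have hb (b) : D.mate (upPoint t n (Sum.inr b)) = upPoint t n (Sum.inr !b) := by
    cases b
    · exact h'
    · exact h
  have key (x) : ∃ y, D.mate (upPoint t n (Sum.inl x)) = upPoint t n (Sum.inl y) := by
    obtain ⟨y | b, hy⟩ := (upPoint_bijective t n).2 (D.mate (upPoint t n (Sum.inl x)))
    · exact ⟨y, hy.symm⟩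
    · have := hb b
      rw [hy, mate_mate] at this
      simpa using (upPoint_bijective t n).1 this
  choose m hm using key
  have hinj : Function.Injective fun x => upPoint t n (Sum.inl x) := fun x y hxy =>
    Sum.inl_injective ((upPoint_bijective t n).1 hxy)
  refine ⟨⟨m, fun x => hinj ?_, fun x hx => ?_, fun x y => ?_⟩, ?_⟩
  · change upPoint t n (Sum.inl (m (m x))) = _
    rw [← hm, ← hm, mate_mate]
  · apply D.mate_ne (upPoint t n (Sum.inl x))
    rw [hm, hx]
  · have := D.planar (upPoint t n (Sum.inl x)) (upPoint t n (Sum.inl y))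
    rw [hm, hm] at this
    simp only [boundaryPos_upPoint_inl] at this
    split_ifs at this <;> omega
  · ext1
    ext1 x
    obtain ⟨x | b, rfl⟩ := (upPoint_bijective t n).2 x
    · rw [up_mate, hm]; rfl
    · rw [up_mate, hb]; rfl

/-! ### Spin weights of diagrams -/

/-- The weight of a diagram for given spins of the boundary points: every arc joins opposite spins
and contributes the weight of the spin at its first end. -/
noncomputable def spinWeight (A : ℂ) {t n : ℕ} (D : TLDiagram t n) (σ : Fin t ⊕ Fin n → Bool) : ℂ :=
  ∏ x, if boundaryPos t n x < boundaryPos t n (D.mate x) then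
    (if σ x = σ (D.mate x) then 0 else arcWeight A (σ x)) else 1

theorem spinWeight_up (A : ℂ) {t n : ℕ} (D : TLDiagram t n) (σ) :
    spinWeight A D.up σ =
      (if σ (Sum.inl (Fin.last t)) = σ (Sum.inr (Fin.last n)) then 0 else
        arcWeight A (σ (Sum.inl (Fin.last t)))) *
      spinWeight A D (fun x => σ (upPoint t n (Sum.inl x))) := by
  rw [spinWeight, ← (upEquiv t n).prod_comp, Fintype.prod_sum_type, mul_comm]
  congr 1
  · simp only [upEquiv_apply, up_mate, Sum.map_inr, boundaryPos_upPoint_inr, Fintype.prod_bool]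
    simp [upPoint]
  · refine Finset.prod_congr rfl fun x _ => ?_
    simp only [upEquiv_apply, up_mate, Sum.map_inl, boundaryPos_upPoint_inl]
    congr 1
    rw [eq_iff_iff]
    split_ifs <;> omega

theorem spinWeight_down (A : ℂ) {t n : ℕ} (D : TLDiagram (t + 1) n) (σ) :
    spinWeight A D.down σ = spinWeight A D (fun x => σ (downPoint t n x)) := by
  rw [spinWeight, ← (downPointEquiv t n).prod_comp]
  simp only [downPointEquiv_apply, down_mate, boundaryPos_downPoint]
  rfl

end TLDiagram

/-! ### Half diagrams as monic planar matchings -/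

namespace HalfDiagram

/-- The Temperley-Lieb diagram of a half diagram. -/
noncomputable def toTLDiagram : {t n : ℕ} → HalfDiagram t n → TLDiagram t n
  | _, _, nil => ⟨id, fun _ => rfl, fun x => x.elim Fin.elim0 Fin.elim0,
      fun x => x.elim Fin.elim0 Fin.elim0⟩
  | _, _, up D => (toTLDiagram D).up
  | _, _, down D => (toTLDiagram D).down

theorem isMonic_toTLDiagram {t n : ℕ} (D : HalfDiagram t n) : D.toTLDiagram.IsMonic := by
  induction D with
  | nil => exact fun i => i.elim0
  | up D ih => exact TLDiagram.isMonic_up.2 ih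
  | down D ih => exact TLDiagram.isMonic_down ih

theorem toTLDiagram_injective {t n : ℕ} :
    Function.Injective (toTLDiagram : HalfDiagram t n → TLDiagram t n) := by
  intro D D' h
  have hne {t n : ℕ} (D : HalfDiagram t n) (D' : HalfDiagram (t + 2) n) :
      D.toTLDiagram.up ≠ D'.toTLDiagram.down := by
    intro h
    obtain ⟨j, hj⟩ := isMonic_toTLDiagram D' (Fin.last (t + 1))
    have h1 := congrArg (fun E => E.mate (Sum.inr (Fin.last n))) h
    have h2 := TLDiagram.down_mate D'.toTLDiagram (Sum.inl (Fin.last (t + 1)))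
    rw [hj, TLDiagram.downPoint_last] at h2
    have h3 := TLDiagram.up_mate D.toTLDiagram (Sum.inr true)
    simp only [h2] at h1
    rw [TLDiagram.upPoint, h1] at h3
    simp [TLDiagram.upPoint] at h3
  induction D with
  | nil => cases D'; rfl
  | @up t n D ih =>
    cases D' with
    | up D' => rw [ih (TLDiagram.up_injective h)]
    | down D' => exact absurd h (hne _ _)
  | @down t n D ih =>
    cases D' with
    | up D' => exact absurd h.symm (hne _ _)
    | down D' =>
      rw [ih]
      rw [← TLDiagram.undown_down D.toTLDiagram, ← TLDiagram.undown_down D'.toTLDiagram]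
      exact congrArg _ h

/-- The partner of the last top point decides. If it is a top point, the last top point can be bent
down; if it is a bottom point, planarity makes it the last one and the strand can be removed. -/
theorem exists_toTLDiagram_eq {t n : ℕ} (D : TLDiagram t n) (hD : D.IsMonic) :
    ∃ E : HalfDiagram t n, E.toTLDiagram = D := by
  induction n generalizing t with
  | zero =>
    cases t with
    | zero =>
      refine ⟨nil, ?_⟩
      ext1
      ext1 x
      exact x.elim Fin.elim0 Fin.elim0
    | succ t => exact (hD 0).choose.elim0
  | succ n ih =>
    cases h : D.mate (Sum.inr (Fin.last n)) with
    | inl i =>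
      cases t with
      | zero => exact i.elim0
      | succ t =>
        obtain rfl := hD.eq_last h
        obtain ⟨E, rfl⟩ := TLDiagram.exists_up_eq h
        obtain ⟨E, rfl⟩ := ih E (TLDiagram.isMonic_up.1 hD)
        exact ⟨up E, rfl⟩
    | inr j =>
      obtain ⟨E, hE⟩ := ih _ (TLDiagram.isMonic_undown hD h)
      exact ⟨down E, by rw [toTLDiagram, hE, TLDiagram.down_undown]⟩

/-- Half diagrams are the monic Temperley-Lieb diagrams. -/
noncomputable def equivMonic (t n : ℕ) : HalfDiagram t n ≃ MonicTLDiagram t n :=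
  Equiv.ofBijective (fun D => ⟨D.toTLDiagram, D.isMonic_toTLDiagram⟩)
    ⟨fun _ _ h => toTLDiagram_injective (congrArg Subtype.val h), fun D => by
      obtain ⟨E, hE⟩ := exists_toTLDiagram_eq D.1 D.2
      exact ⟨E, Subtype.ext hE⟩⟩

theorem equivMonic_apply_val {t n : ℕ} (D : HalfDiagram t n) :
    (equivMonic t n D).1 = D.toTLDiagram := rfl

/-- In the spin weight every arc joins opposite spins, while the operator carries a spin unchanged
along a through strand. Hence the negated bottom spins, and one arc weight for each through strand.
-/
theorem spinWeight_toTLDiagram (A : ℂ) {t n : ℕ} (D : HalfDiagram t n)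
    (β : Fin t → Bool) (σ : Fin n → Bool) :
    D.toTLDiagram.spinWeight A (Sum.elim β σ) =
      (∏ i, arcWeight A (β i)) *
        act A D (tensorWord (word t fun i => !β i) (SpinVec.top 0)) (word n σ) := by
  induction D with
  | nil => simp [TLDiagram.spinWeight, act, tensorWord, word, SpinVec.top]
  | @up t n D ih =>
    have h : (fun x => Sum.elim β σ (TLDiagram.upPoint t n (Sum.inl x))) =
        Sum.elim (Fin.init β) (Fin.init σ) := by
      ext1 x; rcases x with i | j <;> rfl
    rw [toTLDiagram, TLDiagram.spinWeight_up, h, ih, Fin.prod_univ_castSucc]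
    have h2 : act A D.up (tensorWord (word (t + 1) fun i => !β i) (SpinVec.top 0))
        (word (n + 1) σ) = act A D (slice (tensor (!β (Fin.last t))
          (tensorWord (word t fun i => !Fin.init β i) (SpinVec.top 0))) (σ (Fin.last n)))
          (word n (Fin.init σ)) := rfl
    rw [h2, slice_tensor]
    simp only [Sum.elim_inl, Sum.elim_inr]
    have key (b s : Bool) (P : ℂ) (g : SpinVec) (τ : List Bool) :
        (if b = s then 0 else arcWeight A b) * (P * act A D g τ) =
          P * arcWeight A b * act A D (if s = !b then g else 0) τ := by
      cases b <;> cases s <;> simp [act_zero] <;> ring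
    exact key _ _ _ _ _
  | @down t n D ih =>
    have h : (fun x => Sum.elim β σ (TLDiagram.downPoint t n x)) =
        Sum.elim (Fin.snoc β (σ (Fin.last n)) : Fin (t + 1) → Bool) (Fin.init σ) := by
      ext1 x
      rcases x with i | j
      · induction i using Fin.lastCases <;> simp
      · rfl
    rw [toTLDiagram, TLDiagram.spinWeight_down, h, ih, Fin.prod_univ_castSucc]
    have h2 : act A D.down (tensorWord (word t fun i => !β i) (SpinVec.top 0)) (word (n + 1) σ) =
        arcWeight A (σ (Fin.last n)) * act A D (tensor (!σ (Fin.last n))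
          (tensorWord (word t fun i => !β i) (SpinVec.top 0))) (word n (Fin.init σ)) := by
      simp only [word, act]
    have h3 : (word (t + 1) fun i => !(Fin.snoc β (σ (Fin.last n)) : Fin (t + 1) → Bool) i) =
        (!σ (Fin.last n)) :: word t (fun i => !β i) := by
      simp only [word, Fin.snoc_last]
      congr 2
      ext1 i
      simp [Fin.init]
    rw [h2, h3, tensorWord]
    simp only [Fin.snoc_castSucc, Fin.snoc_last]
    ring

/-- The spins of the boundary points that belong to a vector in the tensor power: the bottom points
carry the spin opposite to the highest weight. -/
def boundarySpin (t : ℕ) {n : ℕ} (σ : Fin n → Bool) : Fin t ⊕ Fin n → Bool :=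
  Sum.elim (fun _ => false) σ

theorem spinWeight_boundarySpin (A : ℂ) {t n : ℕ} (D : HalfDiagram t n) (σ : Fin n → Bool) :
    D.toTLDiagram.spinWeight A (boundarySpin t σ) = A⁻¹ ^ t * vec A D (word n σ) := by
  have h (t : ℕ) : tensorWord (word t fun _ => true) (SpinVec.top 0) = SpinVec.top t := by
    induction t with
    | zero => rfl
    | succ t ih => rw [word, tensorWord]; exact congrArg _ ih
  rw [boundarySpin, spinWeight_toTLDiagram]
  simp [arcWeight, vec, h]

end HalfDiagram

/-! ### Components of a graph under rewiring -/

namespace SimpleGraph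

/-- The graph `G'` arises from `G` by replacing the path `x - a - b - y` by the edge `x - y` and the
component `a - b`. -/
structure IsRewiring {V : Type*} (G G' : SimpleGraph V) (a b x y : V) : Prop where
  adj_ab : G.Adj a b
  adj_ax : G.Adj a x
  adj_by : G.Adj b y
  x_ne_a : x ≠ a
  x_ne_b : x ≠ b
  y_ne_a : y ≠ a
  y_ne_b : y ≠ b
  adj_ab' : G'.Adj a b
  adj_xy' : G'.Adj x y
  adj_imp : ∀ u v, u ≠ a → u ≠ b → v ≠ a → v ≠ b → G.Adj u v → G'.Adj u v
  imp_adj : ∀ u v, u ≠ a → u ≠ b → v ≠ a → v ≠ b → G'.Adj u v →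
    G.Adj u v ∨ (u = x ∧ v = y) ∨ (u = y ∧ v = x)
  eq_of_adj_a : ∀ v, G.Adj a v → v = b ∨ v = x
  eq_of_adj_b : ∀ v, G.Adj b v → v = a ∨ v = y
  eq_of_adj_a' : ∀ v, G'.Adj a v → v = b
  eq_of_adj_b' : ∀ v, G'.Adj b v → v = a

namespace IsRewiring

variable {V : Type*} {G G' : SimpleGraph V} {a b x y : V}

open Classical in
/-- Move the points `a` and `b` to `x`. -/
noncomputable def collapse (a b x u : V) : V := if u = a ∨ u = b then x else u

theorem collapse_of_ne {u : V} (ha : u ≠ a) (hb : u ≠ b) : collapse a b x u = u := by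
  simp [collapse, ha, hb]

theorem reachable_collapse (h : IsRewiring G G' a b x y) (u : V) :
    G.Reachable u (collapse a b x u) := by
  by_cases ha : u = a
  · subst ha
    simpa [collapse] using h.adj_ax.reachable
  by_cases hb : u = b
  · subst hb
    simpa [collapse] using h.adj_ab.symm.reachable.trans h.adj_ax.reachable
  rw [collapse_of_ne ha hb]

theorem collapse_ne (h : IsRewiring G G' a b x y) (u : V) :
    collapse a b x u ≠ a ∧ collapse a b x u ≠ b := by
  unfold collapse
  split_ifs with hu
  · exact ⟨h.x_ne_a, h.x_ne_b⟩
  · exact not_or.1 hu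

/-- Contracting a and b to x turns each edge of G into an edge of G' or a single point; the edge b -
y becomes the new edge x - y. -/
theorem reachable_of_reachable (h : IsRewiring G G' a b x y) {u v : V} (huv : G.Reachable u v) :
    G'.Reachable (collapse a b x u) (collapse a b x v) := by
  rw [reachable_iff_reflTransGen] at huv
  induction huv with
  | refl => exact Reachable.refl _
  | @tail v w _ hvw ih =>
    refine ih.trans ?_
    have ha : collapse a b x a = x := by simp [collapse]
    have hb : collapse a b x b = x := by simp [collapse]
    have hx : collapse a b x x = x := collapse_of_ne h.x_ne_a h.x_ne_b
    have hy : collapse a b x y = y := collapse_of_ne h.y_ne_a h.y_ne_b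
    have hxy := h.adj_xy'.reachable
    by_cases hva : v = a
    · subst hva
      rcases h.eq_of_adj_a _ hvw with rfl | rfl
      · rw [ha, hb]
      · rw [ha, hx]
    by_cases hvb : v = b
    · subst hvb
      rcases h.eq_of_adj_b _ hvw with rfl | rfl
      · rw [ha, hb]
      · rwa [hb, hy]
    by_cases hwa : w = a
    · subst hwa
      rcases h.eq_of_adj_a _ hvw.symm with rfl | rfl
      · rw [ha, hb]
      · rw [ha, hx]
    by_cases hwb : w = b
    · subst hwb
      rcases h.eq_of_adj_b _ hvw.symm with rfl | rfl
      · rw [ha, hb]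
      · rw [hb, hy]; exact hxy.symm
    rw [collapse_of_ne hva hvb, collapse_of_ne hwa hwb]
    exact (h.adj_imp _ _ hva hvb hwa hwb hvw).reachable

/-- In G' the points a and b form a component of their own, and the new edge x - y is the path x - a
- b - y of G. -/
theorem of_reachable (h : IsRewiring G G' a b x y) {u v : V} (huv : G'.Reachable u v) :
    ((u = a ∨ u = b) ∧ (v = a ∨ v = b)) ∨ (u ≠ a ∧ u ≠ b ∧ v ≠ a ∧ v ≠ b ∧ G.Reachable u v) := by
  rw [reachable_iff_reflTransGen] at huv
  induction huv with
  | refl =>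
    by_cases hu : u = a ∨ u = b
    · exact Or.inl ⟨hu, hu⟩
    · exact Or.inr ⟨(not_or.1 hu).1, (not_or.1 hu).2, (not_or.1 hu).1, (not_or.1 hu).2,
        Reachable.refl _⟩
  | @tail v w _ hvw ih =>
    have hxy : G.Reachable x y :=
      h.adj_ax.symm.reachable.trans (h.adj_ab.reachable.trans h.adj_by.reachable)
    rcases ih with ⟨hu, rfl | rfl⟩ | ⟨hua, hub, hva, hvb, huv⟩
    · exact Or.inl ⟨hu, Or.inr (h.eq_of_adj_a' _ hvw)⟩
    · exact Or.inl ⟨hu, Or.inl (h.eq_of_adj_b' _ hvw)⟩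
    · have hwa : w ≠ a := by
        rintro rfl
        exact hvb (h.eq_of_adj_a' _ hvw.symm)
      have hwb : w ≠ b := by
        rintro rfl
        exact hva (h.eq_of_adj_b' _ hvw.symm)
      refine Or.inr ⟨hua, hub, hwa, hwb, huv.trans ?_⟩
      rcases h.imp_adj _ _ hva hvb hwa hwb hvw with h' | ⟨rfl, rfl⟩ | ⟨rfl, rfl⟩
      · exact h'.reachable
      · exact hxy
      · exact hxy.symm

theorem reachable_iff (h : IsRewiring G G' a b x y) {u v : V} (hua : u ≠ a) (hub : u ≠ b)
    (hva : v ≠ a) (hvb : v ≠ b) : G'.Reachable u v ↔ G.Reachable u v := by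
  constructor
  · intro huv
    rcases h.of_reachable huv with ⟨hu, _⟩ | ⟨_, _, _, _, h'⟩
    · exact absurd hu (by simp [hua, hub])
    · exact h'
  · intro huv
    have := h.reachable_of_reachable huv
    rwa [collapse_of_ne hua hub, collapse_of_ne hva hvb] at this

/-- The components of the rewired graph. -/
noncomputable def componentMap (h : IsRewiring G G' a b x y) :
    Option G.ConnectedComponent → G'.ConnectedComponent
  | none => G'.connectedComponentMk a
  | some c => Quot.lift (fun u => G'.connectedComponentMk (collapse a b x u))
      (fun _ _ huv => ConnectedComponent.sound (h.reachable_of_reachable huv)) c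

theorem componentMap_some (h : IsRewiring G G' a b x y) (u : V) :
    h.componentMap (some (G.connectedComponentMk u)) =
      G'.connectedComponentMk (collapse a b x u) := rfl

theorem componentMap_bijective (h : IsRewiring G G' a b x y) :
    Function.Bijective h.componentMap := by
  have hne (u : V) : ¬ G'.Reachable a (collapse a b x u) := by
    intro hr
    have := h.collapse_ne u
    rcases h.of_reachable hr with ⟨_, h'⟩ | ⟨h', _⟩
    · exact absurd h' (not_or.2 this)
    · exact h' rfl
  constructor
  · rintro (_ | c) (_ | c') hc
    · rfl
    · induction c' using ConnectedComponent.ind with | _ u =>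
      exact absurd (ConnectedComponent.exact hc) (hne u)
    · induction c using ConnectedComponent.ind with | _ u =>
      exact absurd (ConnectedComponent.exact hc.symm) (hne u)
    · induction c using ConnectedComponent.ind with | _ u =>
      induction c' using ConnectedComponent.ind with | _ v =>
      have hr := ConnectedComponent.exact hc
      rw [h.reachable_iff (h.collapse_ne u).1 (h.collapse_ne u).2 (h.collapse_ne v).1
        (h.collapse_ne v).2] at hr
      congr 1
      exact ConnectedComponent.sound
        ((h.reachable_collapse u).trans (hr.trans (h.reachable_collapse v).symm))
  · intro c
    induction c using ConnectedComponent.ind with | _ u =>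
    by_cases hu : u = a ∨ u = b
    · refine ⟨none, ConnectedComponent.sound ?_⟩
      rcases hu with rfl | rfl
      · rfl
      · exact h.adj_ab'.reachable
    · refine ⟨some (G.connectedComponentMk u), ?_⟩
      rw [componentMap_some, collapse_of_ne (not_or.1 hu).1 (not_or.1 hu).2]

/-- The only additional component is {a, b}, which satisfies p. The others lose or keep only a and
b, so their condition is unaffected. -/
theorem card_components [Finite V] (h : IsRewiring G G' a b x y) (p : V → Prop)
    (ha : p a) (hb : p b) :
    Nat.card {c : G'.ConnectedComponent // ∀ v, G'.connectedComponentMk v = c → p v} =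
      Nat.card {c : G.ConnectedComponent // ∀ v, G.connectedComponentMk v = c → p v} + 1 := by
  rw [← Finite.card_option]
  refine (Nat.card_congr ?_).symm
  have key (c : G.ConnectedComponent) : (∀ v, G'.connectedComponentMk v = h.componentMap (some c) →
      p v) ↔ ∀ v, G.connectedComponentMk v = c → p v := by
    induction c using ConnectedComponent.ind with | _ u =>
    have hu := h.collapse_ne u
    simp only [componentMap_some, ConnectedComponent.eq]
    constructor
    · intro hp v hv
      by_cases hva : v = a
      · rwa [hva]
      by_cases hvb : v = b
      · rwa [hvb]
      exact hp v ((h.reachable_iff hva hvb hu.1 hu.2).2 (hv.trans (h.reachable_collapse u)))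
    · intro hp v hv
      rcases h.of_reachable hv with ⟨_, h'⟩ | ⟨_, _, _, _, h'⟩
      · exact absurd h' (not_or.2 hu)
      · exact hp v (h'.trans (h.reachable_collapse u).symm)
  have key' : ∀ v, G'.connectedComponentMk v = h.componentMap none → p v := by
    intro v hv
    rcases h.of_reachable (ConnectedComponent.exact hv) with ⟨rfl | rfl, _⟩ | ⟨_, _, h', _⟩
    · exact ha
    · exact hb
    · exact absurd rfl h'
  refine Equiv.ofBijective (fun o => match o with
    | none => ⟨h.componentMap none, key'⟩
    | some c => ⟨h.componentMap (some c.1), (key c.1).2 c.2⟩) ⟨?_, ?_⟩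
  · rintro (_ | ⟨c, hc⟩) (_ | ⟨c', hc'⟩) heq
    · rfl
    · have : none = some c' := h.componentMap_bijective.1 (congrArg Subtype.val heq)
      simp at this
    · have : some c = none := h.componentMap_bijective.1 (congrArg Subtype.val heq)
      simp at this
    · have : some c = some c' := h.componentMap_bijective.1 (congrArg Subtype.val heq)
      simpa using this
  · rintro ⟨c, hc⟩
    obtain ⟨o, rfl⟩ := h.componentMap_bijective.2 c
    rcases o with _ | c
    · exact ⟨none, rfl⟩
    · exact ⟨some ⟨c, (key c).1 hc⟩, rfl⟩

end IsRewiring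

end SimpleGraph

/-! ### Rewiring a diagram inside a product -/

namespace TLDiagram

theorem stack_adj {r s n : ℕ} {E : TLDiagram s n} {D : TLDiagram r s}
    {u v : Fin r ⊕ (Fin s ⊕ Fin n)} : (stack E D).Adj u v ↔
      (∃ x : Fin r ⊕ Fin s, u = Sum.map id Sum.inl x ∧ v = Sum.map id Sum.inl (D.mate x)) ∨
      (∃ x : Fin s ⊕ Fin n, u = Sum.inr x ∧ v = Sum.inr (E.mate x)) := by
  have hinj : Function.Injective (Sum.map id Sum.inl : Fin r ⊕ Fin s → Fin r ⊕ (Fin s ⊕ Fin n)) :=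
    Sum.map_injective.2 ⟨Function.injective_id, Sum.inl_injective⟩
  rw [stack, SimpleGraph.fromRel_adj]
  constructor
  · rintro ⟨-, h | ⟨x, rfl, rfl⟩ | ⟨x, rfl, rfl⟩⟩
    · exact h
    · exact Or.inl ⟨D.mate x, rfl, by rw [mate_mate]⟩
    · exact Or.inr ⟨E.mate x, rfl, by rw [mate_mate]⟩
  · intro h
    refine ⟨?_, Or.inl h⟩
    rcases h with ⟨x, rfl, rfl⟩ | ⟨x, rfl, rfl⟩
    · exact fun h => D.mate_ne x (hinj h).symm
    · exact fun h => E.mate_ne x (Sum.inr_injective h).symm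

/-- `D'` arises from `D` by joining the top points `a` and `b` with each other, and the points
that were joined to them with each other. -/
structure IsRewiring {r s : ℕ} (D D' : TLDiagram r s) (a b : Fin s) : Prop where
  ne : D.mate (Sum.inr a) ≠ Sum.inr b
  mate_a : D'.mate (Sum.inr a) = Sum.inr b
  mate_x : D'.mate (D.mate (Sum.inr a)) = D.mate (Sum.inr b)
  mate_of_ne : ∀ z, z ≠ Sum.inr a → z ≠ Sum.inr b → z ≠ D.mate (Sum.inr a) →
    z ≠ D.mate (Sum.inr b) → D'.mate z = D.mate z

variable {r s n : ℕ} {D D' : TLDiagram r s} {a b : Fin s}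

theorem IsRewiring.mate_b (h : IsRewiring D D' a b) : D'.mate (Sum.inr b) = Sum.inr a := by
  rw [← h.mate_a, mate_mate]

theorem IsRewiring.mate_y (h : IsRewiring D D' a b) :
    D'.mate (D.mate (Sum.inr b)) = D.mate (Sum.inr a) := by
  rw [← h.mate_x, mate_mate]

theorem IsRewiring.ne' (h : IsRewiring D D' a b) : D.mate (Sum.inr b) ≠ Sum.inr a := fun h' =>
  h.ne (by rw [← h', mate_mate])

theorem IsRewiring.a_ne_b (h : IsRewiring D D' a b) : a ≠ b := by
  rintro rfl
  exact D'.mate_ne _ h.mate_a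

theorem IsRewiring.stack (h : IsRewiring D D' a b) {E : TLDiagram s n}
    (hE : E.mate (Sum.inl a) = Sum.inl b) :
    SimpleGraph.IsRewiring (stack E D) (stack E D') (Sum.inr (Sum.inl a)) (Sum.inr (Sum.inl b))
      (Sum.map id Sum.inl (D.mate (Sum.inr a))) (Sum.map id Sum.inl (D.mate (Sum.inr b))) := by
  have hinj : Function.Injective (Sum.map id Sum.inl : Fin r ⊕ Fin s → Fin r ⊕ (Fin s ⊕ Fin n)) :=
    Sum.map_injective.2 ⟨Function.injective_id, Sum.inl_injective⟩
  have hE' : E.mate (Sum.inl b) = Sum.inl a := by rw [← hE, mate_mate]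
  have hmid (c : Fin s) : (Sum.inr (Sum.inl c) : Fin r ⊕ (Fin s ⊕ Fin n)) =
      Sum.map id Sum.inl (Sum.inr c : Fin r ⊕ Fin s) := rfl
  have hadjA {D : TLDiagram r s} {v} (c : Fin s) :
      (TLDiagram.stack E D).Adj (Sum.inr (Sum.inl c)) v →
      v = Sum.map id Sum.inl (D.mate (Sum.inr c)) ∨ v = Sum.inr (E.mate (Sum.inl c)) := by
    rw [stack_adj]
    rintro (⟨z, hz, rfl⟩ | ⟨z, hz, rfl⟩)
    · rw [hmid] at hz
      rw [← hinj hz]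
      exact Or.inl rfl
    · rw [← Sum.inr_injective hz]
      exact Or.inr rfl
  refine ⟨?_, ?_, ?_, ?_, ?_, ?_, ?_, ?_, ?_, ?_, ?_, ?_, ?_, ?_, ?_⟩
  · exact stack_adj.2 (Or.inr ⟨Sum.inl a, rfl, by rw [hE]⟩)
  · exact stack_adj.2 (Or.inl ⟨Sum.inr a, rfl, rfl⟩)
  · exact stack_adj.2 (Or.inl ⟨Sum.inr b, rfl, rfl⟩)
  · rw [hmid]; exact fun h' => D.mate_ne _ (hinj h')
  · rw [hmid]; exact fun h' => h.ne (hinj h')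
  · rw [hmid]; exact fun h' => h.ne' (hinj h')
  · rw [hmid]; exact fun h' => D.mate_ne _ (hinj h')
  · exact stack_adj.2 (Or.inr ⟨Sum.inl a, rfl, by rw [hE]⟩)
  · exact stack_adj.2 (Or.inl ⟨_, rfl, by rw [h.mate_x]⟩)
  · intro u v hua hub hva hvb huv
    rw [stack_adj] at huv ⊢
    rcases huv with ⟨z, rfl, rfl⟩ | h'
    · rw [hmid] at hua hub hva hvb
      refine Or.inl ⟨z, rfl, ?_⟩
      rw [h.mate_of_ne z (fun e => hua (by rw [e])) (fun e => hub (by rw [e]))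
        (fun e => hva (by rw [e, mate_mate])) (fun e => hvb (by rw [e, mate_mate]))]
    · exact Or.inr h'
  · intro u v hua hub hva hvb huv
    rw [stack_adj] at huv ⊢
    rcases huv with ⟨z, rfl, rfl⟩ | h'
    · rw [hmid] at hua hub hva hvb
      by_cases h1 : z = D.mate (Sum.inr a)
      · rw [h1, h.mate_x]; exact Or.inr (Or.inl ⟨rfl, rfl⟩)
      by_cases h2 : z = D.mate (Sum.inr b)
      · rw [h2, h.mate_y]; exact Or.inr (Or.inr ⟨rfl, rfl⟩)
      refine Or.inl (Or.inl ⟨z, rfl, ?_⟩)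
      rw [h.mate_of_ne z (fun e => hua (by rw [e])) (fun e => hub (by rw [e])) h1 h2]
    · exact Or.inl (Or.inr h')
  · intro v hv
    rcases hadjA a hv with rfl | rfl
    · exact Or.inr rfl
    · exact Or.inl (by rw [hE])
  · intro v hv
    rcases hadjA b hv with rfl | rfl
    · exact Or.inr rfl
    · exact Or.inl (by rw [hE'])
  · intro v hv
    rcases hadjA a hv with rfl | rfl
    · rw [h.mate_a]; rfl
    · rw [hE]
  · intro v hv
    rcases hadjA b hv with rfl | rfl
    · rw [h.mate_b]; rfl
    · rw [hE']

theorem IsRewiring.productIsMonic_iff (h : IsRewiring D D' a b) {E : TLDiagram s n}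
    (hE : E.mate (Sum.inl a) = Sum.inl b) : ProductIsMonic E D' ↔ ProductIsMonic E D :=
  forall_congr' fun i => exists_congr fun j =>
    (h.stack hE).reachable_iff (by simp) (by simp) (by simp) (by simp)

theorem IsRewiring.loops_eq (h : IsRewiring D D' a b) {E : TLDiagram s n}
    (hE : E.mate (Sum.inl a) = Sum.inl b) : loops E D' = loops E D + 1 :=
  (h.stack hE).card_components (fun v => ∃ j : Fin s, v = Sum.inr (Sum.inl j)) ⟨a, rfl⟩ ⟨b, rfl⟩

/-- The path starting at the bottom point i runs through a and b and returns to the bottom at j, so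
these four vertices are all that it reaches. -/
theorem not_productIsMonic {i j : Fin r} {E : TLDiagram s n}
    (ha : D.mate (Sum.inr a) = Sum.inl i) (hb : D.mate (Sum.inr b) = Sum.inl j)
    (hE : E.mate (Sum.inl a) = Sum.inl b) : ¬ ProductIsMonic E D := by
  intro h
  obtain ⟨k, hk⟩ := h i
  have hE' : E.mate (Sum.inl b) = Sum.inl a := by rw [← hE, mate_mate]
  have ha' : D.mate (Sum.inl i) = Sum.inr a := by rw [← ha, mate_mate]
  have hb' : D.mate (Sum.inl j) = Sum.inr b := by rw [← hb, mate_mate]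
  rw [SimpleGraph.reachable_iff_reflTransGen] at hk
  have key : ∀ v, Relation.ReflTransGen (stack E D).Adj (Sum.inl i) v → v = Sum.inl i ∨
      v = Sum.inl j ∨ v = Sum.inr (Sum.inl a) ∨ v = Sum.inr (Sum.inl b) := by
    intro v hv
    induction hv with
    | refl => exact Or.inl rfl
    | @tail v w _ hvw ih =>
      rw [stack_adj] at hvw
      rcases hvw with ⟨z, rfl, rfl⟩ | ⟨z, rfl, rfl⟩
      · rcases z with z | z <;> simp at ih
        · rcases ih with rfl | rfl <;> simp [ha', hb']
        · rcases ih with rfl | rfl <;> simp [ha, hb]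
      · rcases z with z | z <;> simp at ih
        rcases ih with rfl | rfl <;> simp [hE, hE']
  have := key _ hk
  simp at this

end TLDiagram

/-! ### Planarity of the rewired diagram -/

namespace TLDiagram

variable {s n : ℕ}

/-- The rewiring of a diagram at two top points which enclose a set of points closed under `mate`. -/
theorem exists_isRewiring (D : TLDiagram s n) {a b : Fin n}
    (hab : boundaryPos s n (Sum.inr a) < boundaryPos s n (Sum.inr b))
    (hne : D.mate (Sum.inr a) ≠ Sum.inr b)
    (hbetween : ∀ z, boundaryPos s n (Sum.inr a) < boundaryPos s n z →
      boundaryPos s n z < boundaryPos s n (Sum.inr b) →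
      boundaryPos s n (Sum.inr a) < boundaryPos s n (D.mate z) ∧
      boundaryPos s n (D.mate z) < boundaryPos s n (Sum.inr b)) :
    ∃ D' : TLDiagram s n, IsRewiring D D' a b := by
  classical
  obtain ⟨A, hA⟩ : ∃ A : Fin s ⊕ Fin n, A = Sum.inr a := ⟨_, rfl⟩
  obtain ⟨B, hB⟩ : ∃ B : Fin s ⊕ Fin n, B = Sum.inr b := ⟨_, rfl⟩
  rw [← hA, ← hB] at hab hbetween hne
  set X := D.mate A with hX
  set Y := D.mate B with hY
  have mX : D.mate X = A := D.mate_mate A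
  have mY : D.mate Y = B := D.mate_mate B
  have hAB : A ≠ B := by rintro h; rw [h] at hab; exact lt_irrefl _ hab
  have hXA : X ≠ A := D.mate_ne A
  have hYB : Y ≠ B := D.mate_ne B
  have hYA : Y ≠ A := by
    intro h
    apply hne
    rw [hX, ← h, mY]
  have hXY : X ≠ Y := fun h => hAB (D.mate_injective h)
  let m : Fin s ⊕ Fin n → Fin s ⊕ Fin n := fun z =>
    if z = A then B else if z = B then A else if z = X then Y else if z = Y then X else D.mate z
  have mA : m A = B := by simp [m]
  have mB : m B = A := by simp [m]
  have m'X : m X = Y := by simp [m, hXA, hne]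
  have m'Y : m Y = X := by simp [m, hYA, hYB, hXY.symm]
  have mo (z) (h1 : z ≠ A) (h2 : z ≠ B) (h3 : z ≠ X) (h4 : z ≠ Y) : m z = D.mate z := by
    simp [m, h1, h2, h3, h4]
  have cases5 (z) : z = A ∨ z = B ∨ z = X ∨ z = Y ∨ (m z = D.mate z ∧ z ≠ A ∧ z ≠ B ∧ z ≠ X ∧
      z ≠ Y ∧ D.mate z ≠ A ∧ D.mate z ≠ B ∧ D.mate z ≠ X ∧ D.mate z ≠ Y) := by
    by_cases h1 : z = A
    · exact Or.inl h1
    by_cases h2 : z = B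
    · exact Or.inr (Or.inl h2)
    by_cases h3 : z = X
    · exact Or.inr (Or.inr (Or.inl h3))
    by_cases h4 : z = Y
    · exact Or.inr (Or.inr (Or.inr (Or.inl h4)))
    refine Or.inr (Or.inr (Or.inr (Or.inr ⟨mo z h1 h2 h3 h4, h1, h2, h3, h4, ?_, ?_, ?_, ?_⟩)))
    · intro h; exact h3 (by rw [hX, ← h, mate_mate])
    · intro h; exact h4 (by rw [hY, ← h, mate_mate])
    · intro h; exact h1 (D.mate_injective h)
    · intro h; exact h2 (D.mate_injective h)
  have hP : ∀ {z w}, z ≠ w → boundaryPos s n z ≠ boundaryPos s n w :=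
    fun h h' => h (boundaryPos_injective s n h')
  -- The interval between A and B is closed under `mate`, so the partners of its end points lie
  -- outside it.
  have oX : boundaryPos s n X < boundaryPos s n A ∨ boundaryPos s n B < boundaryPos s n X := by
    have h1 := hbetween X
    rw [mX] at h1
    have := hP hXA
    have := hP hne
    omega
  have oY : boundaryPos s n Y < boundaryPos s n A ∨ boundaryPos s n B < boundaryPos s n Y := by
    have h1 := hbetween Y
    rw [mY] at h1
    have := hP hYA
    have := hP hYB
    omega
  -- No remaining arc separates X from Y: it would have to cross the arc from A to X or the arc from
  -- B to Y, or to separate A from B.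
  have other (z) (hz : m z = D.mate z ∧ z ≠ A ∧ z ≠ B ∧ z ≠ X ∧
      z ≠ Y ∧ D.mate z ≠ A ∧ D.mate z ≠ B ∧ D.mate z ≠ X ∧ D.mate z ≠ Y) :
      (¬ (boundaryPos s n z < boundaryPos s n X ∧ boundaryPos s n X < boundaryPos s n (D.mate z) ∧
        boundaryPos s n (D.mate z) < boundaryPos s n Y)) ∧
      (¬ (boundaryPos s n z < boundaryPos s n Y ∧ boundaryPos s n Y < boundaryPos s n (D.mate z) ∧
        boundaryPos s n (D.mate z) < boundaryPos s n X)) ∧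
      (¬ (boundaryPos s n X < boundaryPos s n z ∧ boundaryPos s n z < boundaryPos s n Y ∧
        boundaryPos s n Y < boundaryPos s n (D.mate z))) ∧
      (¬ (boundaryPos s n Y < boundaryPos s n z ∧ boundaryPos s n z < boundaryPos s n X ∧
        boundaryPos s n X < boundaryPos s n (D.mate z))) := by
    obtain ⟨-, h1, h2, h3, h4, h5, h6, h7, h8⟩ := hz
    have := hP h1
    have := hP h2
    have := hP h3
    have := hP h4
    have := hP h5
    have := hP h6
    have := hP h7
    have := hP h8
    have b1 := hbetween z
    have b2 := hbetween (D.mate z)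
    rw [mate_mate] at b2
    have p1 := D.planar z A
    have p2 := D.planar z B
    have p3 := D.planar z X
    have p4 := D.planar z Y
    have p5 := D.planar A z
    have p6 := D.planar B z
    have p7 := D.planar X z
    have p8 := D.planar Y z
    rw [mX] at p3 p7
    rw [mY] at p4 p8
    rw [← hX] at p1 p5
    rw [← hY] at p2 p6
    refine ⟨?_, ?_, ?_, ?_⟩ <;> omega
  refine ⟨⟨m, fun z => ?_, fun z => ?_, fun z w => ?_⟩, ?_⟩
  · rcases cases5 z with rfl | rfl | rfl | rfl | hz
    · rw [mA, mB]
    · rw [mB, mA]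
    · rw [m'X, m'Y]
    · rw [m'Y, m'X]
    · rw [hz.1, mo _ hz.2.2.2.2.2.1 hz.2.2.2.2.2.2.1 hz.2.2.2.2.2.2.2.1 hz.2.2.2.2.2.2.2.2,
        mate_mate]
  · rcases cases5 z with rfl | rfl | rfl | rfl | hz
    · rw [mA]; exact hAB.symm
    · rw [mB]; exact hAB
    · rw [m'X]; exact hXY.symm
    · rw [m'Y]; exact hXY
    · rw [hz.1]; exact D.mate_ne z
  · have bt (z) (hz : m z = D.mate z ∧ z ≠ A ∧ z ≠ B ∧ z ≠ X ∧
        z ≠ Y ∧ D.mate z ≠ A ∧ D.mate z ≠ B ∧ D.mate z ≠ X ∧ D.mate z ≠ Y) := hbetween (D.mate z)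
    simp only [mate_mate] at bt
    have self (z w : Fin s ⊕ Fin n) (hw : m z = w ∧ m w = z) (h : z ≠ w) :
        ¬ (boundaryPos s n z < boundaryPos s n w ∧
          boundaryPos s n w < boundaryPos s n (m z) ∧
          boundaryPos s n (m z) < boundaryPos s n (m w)) := by
      rw [hw.1, hw.2]; omega
    rcases cases5 z with rfl | rfl | rfl | rfl | hz <;>
      rcases cases5 w with rfl | rfl | rfl | rfl | hw
    · omega
    · rw [mA, mB]; omega
    · rw [mA, m'X]; omega
    · rw [mA, m'Y]; omega
    · rw [mA, hw.1]; have := hbetween w; omega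
    · rw [mA, mB]; omega
    · omega
    · rw [mB, m'X]; omega
    · rw [mB, m'Y]; omega
    · rw [mB, hw.1]; have := hbetween w; omega
    · rw [mA, m'X]; omega
    · rw [mB, m'X]; omega
    · omega
    · rw [m'Y, m'X]; omega
    · rw [m'X, hw.1]; have := other w hw; omega
    · rw [mA, m'Y]; omega
    · rw [mB, m'Y]; omega
    · rw [m'Y, m'X]; omega
    · omega
    · rw [m'Y, hw.1]; have := other w hw; omega
    · rw [mA, hz.1]; have := bt z hz; have := hP hz.2.1; have := hP hz.2.2.1; omega
    · rw [mB, hz.1]; have := bt z hz; have := hP hz.2.1; have := hP hz.2.2.1; omega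
    · rw [m'X, hz.1]; have := other z hz; omega
    · rw [m'Y, hz.1]; have := other z hz; omega
    · rw [hz.1, hw.1]; exact D.planar z w
  · subst hA hB
    exact ⟨hne, mA, m'X, mo⟩

/-! ### State sums and the local move -/

/-- The factor of an ordered pair of joined points in the weight of a diagram. -/
noncomputable def arcFactor (A : ℂ) (s n : ℕ) (σ : Fin s ⊕ Fin n → Bool) (x y : Fin s ⊕ Fin n) : ℂ :=
  if boundaryPos s n x < boundaryPos s n y then (if σ x = σ y then 0 else arcWeight A (σ x)) else 1

theorem spinWeight_eq_mul (A : ℂ) (D : TLDiagram s n) (σ) (T : Finset (Fin s ⊕ Fin n)) :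
    spinWeight A D σ = (∏ x ∈ T, arcFactor A s n σ x (D.mate x)) *
      ∏ x ∈ Tᶜ, arcFactor A s n σ x (D.mate x) :=
  (Finset.prod_mul_prod_compl _ _).symm

theorem ne_of_spinWeight_ne_zero {A : ℂ} {D : TLDiagram s n} {σ} (h : spinWeight A D σ ≠ 0)
    (x : Fin s ⊕ Fin n) : σ x ≠ σ (D.mate x) := by
  have key (x) (hx : boundaryPos s n x < boundaryPos s n (D.mate x)) : σ x ≠ σ (D.mate x) := by
    intro he
    apply h
    apply Finset.prod_eq_zero (Finset.mem_univ x)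
    simp [hx, he]
  rcases lt_trichotomy (boundaryPos s n x) (boundaryPos s n (D.mate x)) with hx | hx | hx
  · exact key x hx
  · exact absurd (boundaryPos_injective s n hx).symm (D.mate_ne x)
  · have := key (D.mate x) (by rwa [mate_mate])
    rw [mate_mate] at this
    exact this.symm

/-- The state sum of two diagrams with the bottom points in the state that belongs to the highest
weight vector. -/
noncomputable def stateSum (A : ℂ) (D₁ D₂ : TLDiagram s n) : ℂ :=
  ∑ σ : Fin n → Bool, spinWeight A D₁ (HalfDiagram.boundarySpin s σ) *
    spinWeight A D₂ (HalfDiagram.boundarySpin s σ)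

/-- Flipping the spin at a is an involution on spin assignments, so every term occurs twice. This
isolates the sum over one spin without splitting off a coordinate. -/
theorem sum_sum_update {ι : Type*} [Fintype ι] [DecidableEq ι] (F : (ι → Bool) → ℂ) (a : ι) :
    ∑ σ : ι → Bool, ∑ b : Bool, F (Function.update σ a b) = 2 * ∑ σ : ι → Bool, F σ := by
  have hinv : Function.Involutive fun σ : ι → Bool => Function.update σ a !(σ a) := by
    intro σ; simp
  have h (σ : ι → Bool) : ∑ b : Bool, F (Function.update σ a b) =
      F σ + F (Function.update σ a !(σ a)) := by
    rw [Fintype.sum_bool]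
    have h1 : Function.update σ a (σ a) = σ := Function.update_eq_self a σ
    cases hs : σ a
    · rw [hs] at h1; simp [h1, add_comm]
    · rw [hs] at h1; simp [h1]
  simp only [h, Finset.sum_add_distrib]
  rw [two_mul]
  congr 1
  exact Equiv.sum_comp hinv.toPerm F

theorem sum_sum_update₂ {ι : Type*} [Fintype ι] [DecidableEq ι] (F : (ι → Bool) → ℂ) (a b : ι) :
    ∑ σ : ι → Bool, ∑ u : Bool, ∑ v : Bool, F (Function.update (Function.update σ a u) b v) =
      4 * ∑ σ : ι → Bool, F σ := by
  rw [sum_sum_update (fun σ => ∑ v : Bool, F (Function.update σ b v)) a, sum_sum_update]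
  ring

end TLDiagram

namespace TLDiagram

variable {s n : ℕ}

/-- The factor of an arc between points with given positions and spins. -/
noncomputable def spinFactor (A : ℂ) (p p' : ℕ) (u u' : Bool) : ℂ :=
  if p < p' then (if u = u' then 0 else arcWeight A u) else 1

theorem arcFactor_eq (A : ℂ) (σ : Fin s ⊕ Fin n → Bool) (x y) :
    arcFactor A s n σ x y = spinFactor A (boundaryPos s n x) (boundaryPos s n y) (σ x) (σ y) := rfl

/-- Here t, u are the spins at a, b and v, w those at their partners x, y. If v = w both sides
vanish. If v ≠ w, the left sum has a single nonzero term, while on the right the loop through a and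
b has the two weights A² and A⁻². The three hypotheses on positions are the planar ones. -/
theorem sum_spinFactor {A : ℂ} (hA : A ≠ 0) {a b x y : ℕ} (hab : a < b)
    (h : (x < a ∧ b < y) ∨ (y < x ∧ x < a) ∨ (b < y ∧ y < x)) (v w : Bool) :
    (A ^ 2 + A⁻¹ ^ 2) * ∑ t : Bool, ∑ u : Bool,
      (spinFactor A a b t u * spinFactor A b a u t) *
      (spinFactor A a x t v * spinFactor A x a v t *
        (spinFactor A b y u w * spinFactor A y b w u)) =
    ∑ t : Bool, ∑ u : Bool,
      (spinFactor A a b t u * spinFactor A b a u t) *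
      (spinFactor A a b t u * spinFactor A b a u t *
        (spinFactor A x y v w * spinFactor A y x w v)) := by
  have hlt {p p' : ℕ} (h : p < p') (u u') :
      spinFactor A p p' u u' = if u = u' then 0 else arcWeight A u := by simp [spinFactor, h]
  have hge {p p' : ℕ} (h : p < p') (u u') : spinFactor A p' p u u' = 1 := by
    simp [spinFactor, h.le]
  simp only [hlt hab, hge hab]
  rcases h with ⟨h1, h2⟩ | ⟨h1, h2⟩ | ⟨h1, h2⟩
  · have h3 : x < y := by omega
    simp only [hlt h1, hlt h2, hge h1, hge h2, hlt h3, hge h3, Fintype.sum_bool]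
    cases v <;> cases w <;> simp [arcWeight] <;> field_simp
  · have h3 : y < b := by omega
    simp only [hlt h1, hlt h2, hge h1, hge h2, hlt h3, hge h3, Fintype.sum_bool]
    cases v <;> cases w <;> simp [arcWeight] <;> field_simp
  · have h3 : a < x := by omega
    simp only [hlt h1, hlt h2, hge h1, hge h2, hlt h3, hge h3, Fintype.sum_bool]
    cases v <;> cases w <;> simp [arcWeight] <;> field_simp

theorem boundaryPos_mate_cases (D : TLDiagram s n) {a b : Fin n}
    (hab : boundaryPos s n (Sum.inr a) < boundaryPos s n (Sum.inr b))
    (hne : D.mate (Sum.inr a) ≠ Sum.inr b)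
    (hbetween : ∀ z, boundaryPos s n (Sum.inr a) < boundaryPos s n z →
      boundaryPos s n z < boundaryPos s n (Sum.inr b) →
      boundaryPos s n (Sum.inr a) < boundaryPos s n (D.mate z) ∧
      boundaryPos s n (D.mate z) < boundaryPos s n (Sum.inr b)) :
    (boundaryPos s n (D.mate (Sum.inr a)) < boundaryPos s n (Sum.inr a) ∧
      boundaryPos s n (Sum.inr b) < boundaryPos s n (D.mate (Sum.inr b))) ∨
    (boundaryPos s n (D.mate (Sum.inr b)) < boundaryPos s n (D.mate (Sum.inr a)) ∧
      boundaryPos s n (D.mate (Sum.inr a)) < boundaryPos s n (Sum.inr a)) ∨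
    (boundaryPos s n (Sum.inr b) < boundaryPos s n (D.mate (Sum.inr b)) ∧
      boundaryPos s n (D.mate (Sum.inr b)) < boundaryPos s n (D.mate (Sum.inr a))) := by
  have hP : ∀ {z w}, z ≠ w → boundaryPos s n z ≠ boundaryPos s n w :=
    fun h h' => h (boundaryPos_injective s n h')
  have h1 := hP (D.mate_ne (Sum.inr a))
  have h2 := hP (D.mate_ne (Sum.inr b))
  have h3 := hP hne
  have h4 : D.mate (Sum.inr b) ≠ Sum.inr a := fun h => hne (by rw [← h, mate_mate])
  have h4 := hP h4
  have h5 : D.mate (Sum.inr a) ≠ D.mate (Sum.inr b) := fun h => by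
    rw [D.mate_injective h] at hab
    exact lt_irrefl _ hab
  have h5 := hP h5
  have b1 := hbetween (D.mate (Sum.inr a))
  have b2 := hbetween (D.mate (Sum.inr b))
  have p1 := D.planar (D.mate (Sum.inr a)) (D.mate (Sum.inr b))
  have p2 := D.planar (D.mate (Sum.inr b)) (Sum.inr a)
  have p3 := D.planar (Sum.inr a) (Sum.inr b)
  have p4 := D.planar (Sum.inr b) (Sum.inr a)
  rw [mate_mate] at b1 b2 p2
  rw [mate_mate, mate_mate] at p1
  omega

theorem spinWeight_update (A : ℂ) (D : TLDiagram s n) (σ : Fin s ⊕ Fin n → Bool)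
    {a b x y : Fin s ⊕ Fin n} (u v : Bool) (hax : D.mate a = x) (hby : D.mate b = y)
    (hab : a ≠ b) (hxb : x ≠ b) :
    spinWeight A D (Function.update (Function.update σ a u) b v) =
      spinFactor A (boundaryPos s n a) (boundaryPos s n x) u (σ x) *
      spinFactor A (boundaryPos s n x) (boundaryPos s n a) (σ x) u *
      (spinFactor A (boundaryPos s n b) (boundaryPos s n y) v (σ y) *
      spinFactor A (boundaryPos s n y) (boundaryPos s n b) (σ y) v) *
      ∏ z ∈ ({a, x, b, y} : Finset (Fin s ⊕ Fin n))ᶜ, arcFactor A s n σ z (D.mate z) := by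
  have hya : y ≠ a := fun h => hxb (by rw [← hax, ← h, ← hby, mate_mate])
  have hxa : x ≠ a := by rw [← hax]; exact D.mate_ne a
  have hyb : y ≠ b := by rw [← hby]; exact D.mate_ne b
  have hxy : x ≠ y := by
    rw [← hax, ← hby]; exact fun h => hab (D.mate_injective h)
  have hxm : D.mate x = a := by rw [← hax, mate_mate]
  have hym : D.mate y = b := by rw [← hby, mate_mate]
  rw [spinWeight_eq_mul A D _ {a, x, b, y}]
  congr 1
  · rw [Finset.prod_insert (by simp [hxa.symm, hab, hya.symm]),
      Finset.prod_insert (by simp [hxb, hxy]), Finset.prod_pair hyb.symm, hax, hby, hxm, hym]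
    simp only [arcFactor_eq]
    simp [Function.update_of_ne, hab, hxb, hya, hxa, hyb]
    ring
  · refine Finset.prod_congr rfl fun z hz => ?_
    simp only [Finset.mem_compl, Finset.mem_insert, Finset.mem_singleton, not_or] at hz
    obtain ⟨h1, h2, h3, h4⟩ := hz
    have h5 : D.mate z ≠ a := fun h => h2 (by rw [← hax, ← h, mate_mate])
    have h6 : D.mate z ≠ b := fun h => h4 (by rw [← hby, ← h, mate_mate])
    simp [arcFactor, h1, h3, h5, h6]

theorem spinWeight_update_arc (A : ℂ) (D : TLDiagram s n) (σ : Fin s ⊕ Fin n → Bool)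
    {a b : Fin s ⊕ Fin n} (u v : Bool) (hab : D.mate a = b) :
    spinWeight A D (Function.update (Function.update σ a u) b v) =
      spinFactor A (boundaryPos s n a) (boundaryPos s n b) u v *
      spinFactor A (boundaryPos s n b) (boundaryPos s n a) v u *
      ∏ z ∈ ({a, b} : Finset (Fin s ⊕ Fin n))ᶜ, arcFactor A s n σ z (D.mate z) := by
  have hba : D.mate b = a := by rw [← hab, mate_mate]
  have hne : a ≠ b := by rw [← hab]; exact (D.mate_ne a).symm
  rw [spinWeight_eq_mul A D _ {a, b}]
  congr 1
  · rw [Finset.prod_pair hne, hab, hba]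
    simp [arcFactor_eq, hne]
  · refine Finset.prod_congr rfl fun z hz => ?_
    simp only [Finset.mem_compl, Finset.mem_insert, Finset.mem_singleton, not_or] at hz
    obtain ⟨h1, h2⟩ := hz
    have h5 : D.mate z ≠ a := fun h => h2 (by rw [← hab, ← h, mate_mate])
    have h6 : D.mate z ≠ b := fun h => h1 (by rw [← hba, ← h, mate_mate])
    simp [arcFactor, h1, h2, h5, h6]

theorem boundarySpin_update (σ : Fin n → Bool) (a : Fin n) (u : Bool) :
    HalfDiagram.boundarySpin s (Function.update σ a u) =
      Function.update (HalfDiagram.boundarySpin s σ) (Sum.inr a) u :=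
  (Sum.update_elim_inr).symm

/-- With all spins except those at a and b fixed, the arcs of D₁ other than a - b and the arcs
common to D and D' factor out; the rest is `sum_spinFactor`. -/
theorem IsRewiring.stateSum_eq {A : ℂ} (hA : A ≠ 0) {D₁ D D' : TLDiagram s n} {a b : Fin n}
    (h : IsRewiring D D' a b) (h₁ : D₁.mate (Sum.inr a) = Sum.inr b)
    (hab : boundaryPos s n (Sum.inr a) < boundaryPos s n (Sum.inr b))
    (hbetween : ∀ z, boundaryPos s n (Sum.inr a) < boundaryPos s n z →
      boundaryPos s n z < boundaryPos s n (Sum.inr b) →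
      boundaryPos s n (Sum.inr a) < boundaryPos s n (D.mate z) ∧
      boundaryPos s n (D.mate z) < boundaryPos s n (Sum.inr b)) :
    (A ^ 2 + A⁻¹ ^ 2) * stateSum A D₁ D = stateSum A D₁ D' := by
  apply mul_left_cancel₀ (show (4 : ℂ) ≠ 0 by norm_num)
  rw [mul_left_comm, stateSum, stateSum, ← sum_sum_update₂ _ a b, ← sum_sum_update₂ _ a b,
    Finset.mul_sum]
  refine Finset.sum_congr rfl fun σ _ => ?_
  have hne : (Sum.inr a : Fin s ⊕ Fin n) ≠ Sum.inr b := by simpa using h.a_ne_b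
  have hxy : D.mate (Sum.inr a) ≠ D.mate (Sum.inr b) := fun e => hne (D.mate_injective e)
  have hxa := D.mate_ne (Sum.inr a)
  have hyb := D.mate_ne (Sum.inr b)
  have hD' (u v : Bool) : spinWeight A D' (Function.update (Function.update
      (HalfDiagram.boundarySpin s σ) (Sum.inr a) u) (Sum.inr b) v) =
      spinFactor A (boundaryPos s n (Sum.inr a)) (boundaryPos s n (Sum.inr b)) u v *
      spinFactor A (boundaryPos s n (Sum.inr b)) (boundaryPos s n (Sum.inr a)) v u *
      (spinFactor A (boundaryPos s n (D.mate (Sum.inr a))) (boundaryPos s n (D.mate (Sum.inr b)))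
        (HalfDiagram.boundarySpin s σ (D.mate (Sum.inr a)))
        (HalfDiagram.boundarySpin s σ (D.mate (Sum.inr b))) *
      spinFactor A (boundaryPos s n (D.mate (Sum.inr b))) (boundaryPos s n (D.mate (Sum.inr a)))
        (HalfDiagram.boundarySpin s σ (D.mate (Sum.inr b)))
        (HalfDiagram.boundarySpin s σ (D.mate (Sum.inr a)))) *
      ∏ z ∈ ({Sum.inr a, D.mate (Sum.inr a), Sum.inr b, D.mate (Sum.inr b)} :
        Finset (Fin s ⊕ Fin n))ᶜ, arcFactor A s n (HalfDiagram.boundarySpin s σ) z (D.mate z) := by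
    rw [spinWeight_update_arc A D' _ u v h.mate_a, mul_assoc (_ * _) (_ * _)]
    congr 1
    have hsub : ({D.mate (Sum.inr a), D.mate (Sum.inr b)} : Finset (Fin s ⊕ Fin n)) ⊆
        ({Sum.inr a, Sum.inr b} : Finset (Fin s ⊕ Fin n))ᶜ := by
      intro z
      simp only [Finset.mem_compl, Finset.mem_insert, Finset.mem_singleton, not_or]
      rintro (rfl | rfl)
      · exact ⟨hxa, h.ne⟩
      · exact ⟨h.ne', hyb⟩
    rw [← Finset.prod_sdiff hsub, Finset.prod_pair hxy, h.mate_x, h.mate_y, mul_comm]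
    congr 1
    have hset : ({Sum.inr a, Sum.inr b} : Finset (Fin s ⊕ Fin n))ᶜ \
        {D.mate (Sum.inr a), D.mate (Sum.inr b)} =
        ({Sum.inr a, D.mate (Sum.inr a), Sum.inr b, D.mate (Sum.inr b)} :
        Finset (Fin s ⊕ Fin n))ᶜ := by
      ext z
      simp only [Finset.mem_sdiff, Finset.mem_compl, Finset.mem_insert, Finset.mem_singleton]
      tauto
    rw [hset]
    refine Finset.prod_congr rfl fun z hz => ?_
    simp only [Finset.mem_compl, Finset.mem_insert, Finset.mem_singleton, not_or] at hz
    rw [h.mate_of_ne z hz.1 hz.2.2.1 hz.2.1 hz.2.2.2]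
  simp only [boundarySpin_update, hD', spinWeight_update_arc A D₁ _ _ _ h₁,
    spinWeight_update A D _ _ _ rfl rfl hne h.ne]
  have key := sum_spinFactor hA hab (boundaryPos_mate_cases D hab h.ne hbetween)
    (HalfDiagram.boundarySpin s σ (D.mate (Sum.inr a)))
    (HalfDiagram.boundarySpin s σ (D.mate (Sum.inr b)))
  set R := ∏ z ∈ ({Sum.inr a, D.mate (Sum.inr a), Sum.inr b, D.mate (Sum.inr b)} :
        Finset (Fin s ⊕ Fin n))ᶜ, arcFactor A s n (HalfDiagram.boundarySpin s σ) z (D.mate z)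
  set R₁ := ∏ z ∈ ({Sum.inr a, Sum.inr b} : Finset (Fin s ⊕ Fin n))ᶜ,
    arcFactor A s n (HalfDiagram.boundarySpin s σ) z (D₁.mate z)
  simp only [Fintype.sum_bool] at key ⊢
  linear_combination (R * R₁) * key

/-- All bottom points carry the same spin, so D forces equal spins at a and b, whereas D₁ forces
opposite ones. -/
theorem stateSum_eq_zero (A : ℂ) {D₁ D : TLDiagram s n} {a b : Fin n} {i j : Fin s}
    (h₁ : D₁.mate (Sum.inr a) = Sum.inr b) (ha : D.mate (Sum.inr a) = Sum.inl i)
    (hb : D.mate (Sum.inr b) = Sum.inl j) : stateSum A D₁ D = 0 := by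
  refine Finset.sum_eq_zero fun σ _ => ?_
  by_contra hne
  have h1 := ne_of_spinWeight_ne_zero (left_ne_zero_of_mul hne) (Sum.inr a)
  have h2 := ne_of_spinWeight_ne_zero (right_ne_zero_of_mul hne) (Sum.inr a)
  have h3 := ne_of_spinWeight_ne_zero (right_ne_zero_of_mul hne) (Sum.inr b)
  rw [h₁] at h1
  rw [ha] at h2
  rw [hb] at h3
  simp only [HalfDiagram.boundarySpin, Sum.elim_inr, Sum.elim_inl, ne_eq, Bool.not_eq_false] at h1 h2 h3
  exact h1 (by rw [h2, h3])

end TLDiagram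

/-! ### Mismatches of two diagrams -/

namespace TLDiagram

variable {s n : ℕ}

theorem star_mate (D : TLDiagram s n) (x : Fin n ⊕ Fin s) : D.star.mate x = (D.mate x.swap).swap :=
  rfl

/-- The top points whose arcs in `D₁` join two top points and are not arcs of `D₂`. -/
def mismatches (D₁ D₂ : TLDiagram s n) : Set (Fin n) :=
  {a | ∃ b, D₁.mate (Sum.inr a) = Sum.inr b ∧ D₂.mate (Sum.inr a) ≠ Sum.inr b}

theorem boundaryPos_inr_le_iff {x : Fin s ⊕ Fin n} (a : Fin n)
    (h : boundaryPos s n (Sum.inr a) < boundaryPos s n x) : ∃ b, x = Sum.inr b := by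
  rcases x with i | b
  · have := i.2
    simp only [boundaryPos] at h
    omega
  · exact ⟨b, rfl⟩

/-- A shortest mismatch encloses a set of points on which the two diagrams agree. -/
theorem exists_shortest_mismatch {D₁ D₂ : TLDiagram s n} (h : (mismatches D₁ D₂).Nonempty) :
    ∃ a b : Fin n, D₁.mate (Sum.inr a) = Sum.inr b ∧ D₂.mate (Sum.inr a) ≠ Sum.inr b ∧
      boundaryPos s n (Sum.inr a) < boundaryPos s n (Sum.inr b) ∧
      ∀ z, boundaryPos s n (Sum.inr a) < boundaryPos s n z →
        boundaryPos s n z < boundaryPos s n (Sum.inr b) →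
        boundaryPos s n (Sum.inr a) < boundaryPos s n (D₂.mate z) ∧
        boundaryPos s n (D₂.mate z) < boundaryPos s n (Sum.inr b) := by
  classical
  let S : Finset (Fin n × Fin n) := Finset.univ.filter fun p =>
    D₁.mate (Sum.inr p.1) = Sum.inr p.2 ∧ D₂.mate (Sum.inr p.1) ≠ Sum.inr p.2 ∧
      boundaryPos s n (Sum.inr p.1) < boundaryPos s n (Sum.inr p.2)
  have hmem {a b : Fin n} (h₁ : D₁.mate (Sum.inr a) = Sum.inr b)
      (h₂ : D₂.mate (Sum.inr a) ≠ Sum.inr b) : (a, b) ∈ S ∨ (b, a) ∈ S := by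
    have h₁' : D₁.mate (Sum.inr b) = Sum.inr a := by rw [← h₁, mate_mate]
    have h₂' : D₂.mate (Sum.inr b) ≠ Sum.inr a := fun h => h₂ (by rw [← h, mate_mate])
    have hne : boundaryPos s n (Sum.inr a) ≠ boundaryPos s n (Sum.inr b) := fun h =>
      D₁.mate_ne (Sum.inr a) (h₁.trans (boundaryPos_injective s n h).symm)
    simp only [S, Finset.mem_filter, Finset.mem_univ, true_and]
    rcases lt_or_gt_of_ne hne with h | h
    · exact Or.inl ⟨h₁, h₂, h⟩
    · exact Or.inr ⟨h₁', h₂', h⟩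
  have hS : S.Nonempty := by
    obtain ⟨a, b, h₁, h₂⟩ := h
    rcases hmem h₁ h₂ with h | h
    · exact ⟨_, h⟩
    · exact ⟨_, h⟩
  obtain ⟨⟨a, b⟩, hab, hmin⟩ := S.exists_min_image
    (fun p => boundaryPos s n (Sum.inr p.2) - boundaryPos s n (Sum.inr p.1)) hS
  simp only [S, Finset.mem_filter, Finset.mem_univ, true_and] at hab
  obtain ⟨h₁, h₂, hlt⟩ := hab
  refine ⟨a, b, h₁, h₂, hlt, fun z hz1 hz2 => ?_⟩
  have h₁' : D₁.mate (Sum.inr b) = Sum.inr a := by rw [← h₁, mate_mate]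
  have hin : boundaryPos s n (Sum.inr a) < boundaryPos s n (D₁.mate z) ∧
      boundaryPos s n (D₁.mate z) < boundaryPos s n (Sum.inr b) := by
    have p1 := D₁.planar (Sum.inr a) z
    have p2 := D₁.planar (D₁.mate z) (Sum.inr a)
    rw [h₁] at p1 p2
    rw [mate_mate] at p2
    have e1 : boundaryPos s n (D₁.mate z) ≠ boundaryPos s n (Sum.inr a) := fun h => by
      have := boundaryPos_injective s n h
      have h3 : z = Sum.inr b := by rw [← h₁, ← this, mate_mate]
      rw [h3] at hz2
      exact lt_irrefl _ hz2
    have e2 : boundaryPos s n (D₁.mate z) ≠ boundaryPos s n (Sum.inr b) := fun h => by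
      have := boundaryPos_injective s n h
      have h3 : z = Sum.inr a := by rw [← h₁', ← this, mate_mate]
      rw [h3] at hz1
      exact lt_irrefl _ hz1
    omega
  -- Planarity of D₁ keeps the D₁-partner of z inside the interval. The arc of D₁ at z is shorter
  -- than the minimal mismatch, so it is also an arc of D₂.
  suffices D₂.mate z = D₁.mate z by rwa [this]
  obtain ⟨c, rfl⟩ := boundaryPos_inr_le_iff a hz1
  obtain ⟨e, he⟩ := boundaryPos_inr_le_iff a hin.1
  rw [he] at hin ⊢
  by_contra hne
  rcases hmem he hne with h | h
  · have := hmin _ h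
    simp only at this
    omega
  · have := hmin _ h
    simp only at this
    omega

theorem IsMonic.isRewiring {D D' : TLDiagram s n} {a b : Fin n} (hD : D.IsMonic)
    (h : IsRewiring D D' a b)
    (hxy : (∃ c, D.mate (Sum.inr a) = Sum.inr c) ∨ ∃ c, D.mate (Sum.inr b) = Sum.inr c) :
    D'.IsMonic := by
  intro i
  by_cases h1 : Sum.inl i = D.mate (Sum.inr a)
  · rw [h1, h.mate_x]
    rcases hxy with ⟨c, hc⟩ | hc
    · rw [hc] at h1; cases h1
    · exact hc
  by_cases h2 : Sum.inl i = D.mate (Sum.inr b)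
  · rw [h2, h.mate_y]
    rcases hxy with hc | ⟨c, hc⟩
    · exact hc
    · rw [hc] at h2; cases h2
  rw [h.mate_of_ne _ (by simp) (by simp) h1 h2]
  exact hD i

/-- The mismatch at a is repaired. An arc shared by D₁ and D meets neither a nor b, which D₁ joins
and D does not, so it also avoids their partners in D and survives in D'. -/
theorem IsRewiring.mismatches_ssubset {D₁ D D' : TLDiagram s n} {a b : Fin n}
    (h : IsRewiring D D' a b) (h₁ : D₁.mate (Sum.inr a) = Sum.inr b) :
    mismatches D₁ D' ⊂ mismatches D₁ D := by
  have h₁' : D₁.mate (Sum.inr b) = Sum.inr a := by rw [← h₁, mate_mate]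
  rw [Set.ssubset_iff_of_subset]
  · refine ⟨a, ⟨b, h₁, h.ne⟩, ?_⟩
    rintro ⟨c, hc, hc'⟩
    rw [h.mate_a, ← h₁] at hc'
    exact hc' hc
  · rintro z ⟨w, hz, hz'⟩
    refine ⟨w, hz, fun hw => hz' ?_⟩
    have hza : (Sum.inr z : Fin s ⊕ Fin n) ≠ Sum.inr a := by
      rintro e
      rw [e, h₁] at hz
      rw [e, h.mate_a] at hz'
      exact hz' hz
    have hzb : (Sum.inr z : Fin s ⊕ Fin n) ≠ Sum.inr b := by
      rintro e
      rw [e, h₁'] at hz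
      rw [e, h.mate_b] at hz'
      exact hz' hz
    rw [← hw]
    refine h.mate_of_ne _ hza hzb ?_ ?_
    · intro e
      rw [e, mate_mate] at hw
      rw [← hw, ← h₁'] at hz
      exact hzb (D₁.mate_injective hz)
    · intro e
      rw [e, mate_mate] at hw
      rw [← hw, ← h₁] at hz
      exact hza (D₁.mate_injective hz)

theorem IsMonic.strictMono {D : TLDiagram s n} {f : Fin s → Fin n}
    (hf : ∀ i, D.mate (Sum.inl i) = Sum.inr (f i)) : StrictMono f := by
  intro i j hij
  have hne : f i ≠ f j := fun h => by
    have : D.mate (Sum.inl i) = D.mate (Sum.inl j) := by rw [hf, hf, h]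
    exact hij.ne (Sum.inl_injective (D.mate_injective this))
  have := D.planar (Sum.inl i) (Sum.inl j)
  rw [hf, hf] at this
  simp only [boundaryPos] at this
  have h1 := (f i).2
  have h2 := (f j).2
  have h3 : (f i : ℕ) ≠ f j := fun h => hne (Fin.ext h)
  have h4 : (i : ℕ) < j := hij
  have h5 := j.2
  rw [Fin.lt_def]
  omega

/-- All top arcs of D₁ are arcs of D₂, so the through strands of D₂ end among the s end points of
those of D₁, hence at the same points. Planarity makes both families increasing, so they coincide
strand by strand. -/
theorem eq_of_mismatches_eq_empty {D₁ D₂ : TLDiagram s n} (hD₁ : D₁.IsMonic) (hD₂ : D₂.IsMonic)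
    (h : mismatches D₁ D₂ = ∅) : D₁ = D₂ := by
  have hcommon {a b : Fin n} (hab : D₁.mate (Sum.inr a) = Sum.inr b) :
      D₂.mate (Sum.inr a) = Sum.inr b := by
    by_contra hne
    exact Set.eq_empty_iff_forall_notMem.1 h a ⟨b, hab, hne⟩
  choose f₁ hf₁ using hD₁
  choose f₂ hf₂ using hD₂
  have h₁ := IsMonic.strictMono hf₁
  have h₂ := IsMonic.strictMono hf₂
  have key (i : Fin s) : ∃ k, f₂ i = f₁ k := by
    cases hk : D₁.mate (Sum.inr (f₂ i)) with
    | inl k =>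
      refine ⟨k, ?_⟩
      have := hf₁ k
      rw [← hk, mate_mate] at this
      exact Sum.inr_injective this
    | inr b =>
      have := hcommon hk
      rw [← hf₂, mate_mate] at this
      cases this
  have hrange : Set.range f₂ = Set.range f₁ := by
    apply Set.eq_of_subset_of_ncard_le
    · rintro _ ⟨i, rfl⟩
      obtain ⟨k, hk⟩ := key i
      exact ⟨k, hk.symm⟩
    · rw [← Set.image_univ, ← Set.image_univ, Set.ncard_image_of_injective _ h₁.injective,
        Set.ncard_image_of_injective _ h₂.injective]
    · exact Set.toFinite _
  have hf : f₂ = f₁ := (h₂.range_inj h₁).1 hrange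
  ext1
  ext1 x
  rcases x with i | j
  · rw [hf₁, hf₂, hf]
  · cases hj : D₁.mate (Sum.inr j) with
    | inl k =>
      have := hf₁ k
      rw [← hj, mate_mate, ← hf, ← hf₂] at this
      rw [this, mate_mate]
    | inr b => exact (hcommon hj).symm

theorem productIsMonic_self {D : TLDiagram s n} (hD : D.IsMonic) : ProductIsMonic D.star D := by
  intro i
  obtain ⟨j, hj⟩ := hD i
  refine ⟨i, ?_⟩
  have h1 : (stack D.star D).Adj (Sum.inl i) (Sum.inr (Sum.inl j)) :=
    stack_adj.2 (Or.inl ⟨Sum.inl i, rfl, by rw [hj]; rfl⟩)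
  have h2 : (stack D.star D).Adj (Sum.inr (Sum.inr i)) (Sum.inr (Sum.inl j)) :=
    stack_adj.2 (Or.inr ⟨Sum.inr i, rfl, by rw [star_mate, Sum.swap_inr, hj]; rfl⟩)
  exact h1.reachable.trans h2.symm.reachable

/-- The left ends of the arcs joining two top points. -/
def openers (D : TLDiagram s n) : Set (Fin n) :=
  {j | ∃ k, D.mate (Sum.inr j) = Sum.inr k ∧ j < k}

theorem card_openers {D : TLDiagram s n} (hD : D.IsMonic) :
    n = s + 2 * Nat.card (openers D) := by
  choose f hf using hD
  choose g hg using fun j : openers D => j.2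
  have hmate_g (j) : D.mate (Sum.inr (g j)) = Sum.inr j.1 := by rw [← (hg j).1, mate_mate]
  have hmate_f (i) : D.mate (Sum.inr (f i)) = Sum.inl i := by rw [← hf, mate_mate]
  have hbij : Function.Bijective (Sum.elim f (Sum.elim (fun j : openers D => (j : Fin n)) g)) := by
    constructor
    · intro x y h
      have h' := congrArg (fun z => D.mate (Sum.inr z)) h
      rcases x with i | j | j <;> rcases y with i' | j' | j' <;>
        simp only [Sum.elim_inl, Sum.elim_inr, hmate_f, hmate_g, (hg _).1, Sum.inl.injEq,
          Sum.inr.injEq, reduceCtorEq] at h h'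
      · rw [h']
      · rw [Subtype.ext h]
      · have h1 := (hg j).2
        have h2 := (hg j').2
        rw [h, h'] at h1
        exact absurd (h1.trans h2) (lt_irrefl _)
      · have h1 := (hg j).2
        have h2 := (hg j').2
        rw [h, h'] at h1
        exact absurd (h1.trans h2) (lt_irrefl _)
      · rw [Subtype.ext h']
    · intro j
      cases hj : D.mate (Sum.inr j) with
      | inl i =>
        refine ⟨Sum.inl i, ?_⟩
        have := hf i
        rw [← hj, mate_mate] at this
        exact (Sum.inr_injective this).symm
      | inr k =>
        have hk : D.mate (Sum.inr k) = Sum.inr j := by rw [← hj, mate_mate]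
        rcases lt_trichotomy j k with h | h | h
        · exact ⟨Sum.inr (Sum.inl ⟨j, k, hj, h⟩), rfl⟩
        · exact absurd (hj.trans (by rw [h])) (D.mate_ne _)
        · refine ⟨Sum.inr (Sum.inr ⟨k, j, hk, h⟩), ?_⟩
          exact Sum.inr_injective ((hg ⟨k, j, hk, h⟩).1.symm.trans hk)
  have := Nat.card_congr (Equiv.ofBijective _ hbij)
  rw [Nat.card_sum, Nat.card_sum, Nat.card_fin, Nat.card_fin] at this
  omega

/-- The mirror image closes each arc between top points to a circle through two middle points; the
other middle points lie on through strands and are connected to the bottom. -/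
theorem loops_self (D : TLDiagram s n) : loops D.star D = Nat.card (openers D) := by
  have hadj {j : Fin n} {v} : (stack D.star D).Adj (Sum.inr (Sum.inl j)) v →
      v = Sum.map id Sum.inl (D.mate (Sum.inr j)) ∨ v = Sum.inr (D.mate (Sum.inr j)).swap := by
    rw [stack_adj]
    rintro (⟨z, hz, rfl⟩ | ⟨z, hz, rfl⟩)
    · rcases z with z | z
      · cases hz
      · simp only [Sum.map_inr, Sum.inr.injEq, Sum.inl.injEq] at hz
        rw [hz]; exact Or.inl rfl
    · rw [← Sum.inr_injective hz]
      exact Or.inr rfl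
  have hcomp {j k : Fin n} (hjk : D.mate (Sum.inr j) = Sum.inr k) {v}
      (hv : (stack D.star D).Reachable (Sum.inr (Sum.inl j)) v) :
      v = Sum.inr (Sum.inl j) ∨ v = Sum.inr (Sum.inl k) := by
    have hkj : D.mate (Sum.inr k) = Sum.inr j := by rw [← hjk, mate_mate]
    rw [SimpleGraph.reachable_iff_reflTransGen] at hv
    induction hv with
    | refl => exact Or.inl rfl
    | tail _ hvw ih =>
      rcases ih with rfl | rfl
      · rcases hadj hvw with rfl | rfl <;> rw [hjk] <;> exact Or.inr rfl
      · rcases hadj hvw with rfl | rfl <;> rw [hkj] <;> exact Or.inl rfl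
  have hmid (j : openers D) : ∀ v, (stack D.star D).connectedComponentMk v =
      (stack D.star D).connectedComponentMk (Sum.inr (Sum.inl j.1)) →
      ∃ i : Fin n, v = Sum.inr (Sum.inl i) := by
    obtain ⟨j, k, hjk, -⟩ := j
    intro v hv
    rcases hcomp hjk (SimpleGraph.ConnectedComponent.exact hv).symm with h | h
    · exact ⟨_, h⟩
    · exact ⟨_, h⟩
  symm
  refine Nat.card_congr (Equiv.ofBijective (fun j => ⟨_, hmid j⟩) ⟨?_, ?_⟩)
  · intro j j' h
    have hr := SimpleGraph.ConnectedComponent.exact (congrArg Subtype.val h)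
    obtain ⟨j, k, hjk, hlt⟩ := j
    obtain ⟨j', k', hjk', hlt'⟩ := j'
    rcases hcomp hjk hr with h | h
    · simp only [Sum.inr.injEq, Sum.inl.injEq] at h
      exact Subtype.ext h.symm
    · simp only [Sum.inr.injEq, Sum.inl.injEq] at h
      subst h
      rw [← hjk, mate_mate] at hjk'
      rw [← Sum.inr_injective hjk'] at hlt'
      exact absurd (hlt.trans hlt') (lt_irrefl _)
  · rintro ⟨c, hc⟩
    induction c using SimpleGraph.ConnectedComponent.ind with | _ u =>
    obtain ⟨j, rfl⟩ := hc u rfl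
    have hadj1 : (stack D.star D).Adj (Sum.inr (Sum.inl j))
        (Sum.map id Sum.inl (D.mate (Sum.inr j))) := stack_adj.2 (Or.inl ⟨Sum.inr j, rfl, rfl⟩)
    obtain ⟨k, hk⟩ := hc _ (SimpleGraph.ConnectedComponent.sound hadj1.symm.reachable)
    cases hjk : D.mate (Sum.inr j) with
    | inl i => rw [hjk] at hk; cases hk
    | inr k =>
      have hkj : D.mate (Sum.inr k) = Sum.inr j := by rw [← hjk, mate_mate]
      rcases lt_trichotomy j k with h | h | h
      · exact ⟨⟨j, k, hjk, h⟩, rfl⟩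
      · exact absurd (hjk.trans (by rw [h])) (D.mate_ne _)
      · refine ⟨⟨k, j, hkj, h⟩, Subtype.ext ?_⟩
        rw [hjk] at hadj1
        exact SimpleGraph.ConnectedComponent.sound hadj1.symm.reachable

end TLDiagram

/-! ### The form as a pairing of vectors -/

namespace HalfDiagram

theorem le_size {t n : ℕ} (D : HalfDiagram t n) : t ≤ n := by
  by_contra h
  exact (isEmpty_of_lt (not_le.1 h)).false D

/-- The number k counts the `down` steps, each of which closes up to a loop of value A² + A⁻². -/
theorem pairing_act_self (A : ℂ) {t n : ℕ} (D : HalfDiagram t n) :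
    ∀ k, n = t + 2 * k → ∀ f g, pairing n (act A D f) (act A D g) =
      (A ^ 2 + A⁻¹ ^ 2) ^ k * pairing t f g := by
  induction D with
  | nil =>
    intro k hk f g
    obtain rfl : k = 0 := by omega
    simp [act]
  | up D ih =>
    intro k hk f g
    rw [pairing_succ, pairing_succ]
    simp only [slice_act_up, ih k (by omega)]
    ring
  | down D ih =>
    intro k hk f g
    have := D.le_size
    obtain ⟨k, rfl⟩ : ∃ l, k = l + 1 := ⟨k - 1, by omega⟩
    have h0 (m : ℕ) (s : Bool) : pairing (m + 1) (tensor s f) (tensor s g) = pairing m f g := by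
      rw [pairing_succ]; cases s <;> simp
    rw [pairing_succ]
    simp only [slice_act_down, pairing_smul_left, pairing_smul_right, ih k (by omega), h0]
    simp [arcWeight]
    ring

theorem pairing_top (t : ℕ) : pairing t (SpinVec.top t) (SpinVec.top t) = 1 := by
  induction t with
  | zero => simp [SpinVec.top]
  | succ t ih => simp [pairing_succ, SpinVec.top, ih]

theorem stateSum_toTLDiagram (A : ℂ) {t n : ℕ} (D D' : HalfDiagram t n) :
    TLDiagram.stateSum A D.toTLDiagram D'.toTLDiagram =
      A⁻¹ ^ (2 * t) * pairing n (vec A D) (vec A D') := by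
  simp only [TLDiagram.stateSum, spinWeight_boundarySpin, pairing, Finset.mul_sum]
  refine Finset.sum_congr rfl fun σ _ => ?_
  ring

end HalfDiagram

/-- Induction on the number of mismatches. Rewiring D₂ at a shortest mismatch multiplies both sides
by the loop value, which can be cancelled since q + q⁻¹ ≠ 0. If both end points lie on through
strands of D₂, rewiring would destroy monicity, but then both sides vanish. The factor A⁻¹ ^ (2 * t)
is the weight of the t through strands in each of the two diagrams. -/
theorem stateSum_eq_diagramForm {A q : ℂ} (hA : A ^ 2 = -q) (hq : q ≠ 0) (hδ : q + q⁻¹ ≠ 0)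
    {t n : ℕ} (D₁ D₂ : MonicTLDiagram t n) :
    TLDiagram.stateSum A D₁.1 D₂.1 = A⁻¹ ^ (2 * t) * diagramForm q D₁ D₂ := by
  have hA0 : A ≠ 0 := by rintro rfl; simp at hA; exact hq hA
  have hAδ : A ^ 2 + A⁻¹ ^ 2 = -(q + q⁻¹) := by rw [inv_pow, hA, inv_neg]; ring
  obtain ⟨m, hm⟩ : ∃ m, m = (TLDiagram.mismatches D₁.1 D₂.1).ncard := ⟨_, rfl⟩
  induction m using Nat.strong_induction_on generalizing D₂ with
  | _ m ih =>
    by_cases h : (TLDiagram.mismatches D₁.1 D₂.1).Nonempty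
    · obtain ⟨a, b, h₁, hne, hlt, hbetween⟩ := TLDiagram.exists_shortest_mismatch h
      have hE : D₁.1.star.mate (Sum.inl a) = Sum.inl b := by
        rw [TLDiagram.star_mate, Sum.swap_inl, h₁]; rfl
      by_cases hxy : (∃ c, D₂.1.mate (Sum.inr a) = Sum.inr c) ∨
          ∃ c, D₂.1.mate (Sum.inr b) = Sum.inr c
      · obtain ⟨D', hD'⟩ := TLDiagram.exists_isRewiring D₂.1 hlt hne hbetween
        have h1 := ih _ (by
          rw [hm]
          exact Set.ncard_lt_ncard (hD'.mismatches_ssubset h₁)) ⟨D', D₂.2.isRewiring hD' hxy⟩ rfl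
        have h2 := hD'.stateSum_eq hA0 h₁ hlt hbetween
        rw [hAδ] at h2
        apply mul_left_cancel₀ (neg_ne_zero.2 hδ)
        rw [h2, h1, diagramForm, diagramForm]
        by_cases hp : TLDiagram.ProductIsMonic D₁.1.star D₂.1
        · rw [if_pos hp, if_pos ((hD'.productIsMonic_iff hE).2 hp), hD'.loops_eq hE]
          ring
        · rw [if_neg hp, if_neg (mt (hD'.productIsMonic_iff hE).1 hp)]
          ring
      · have hi : ∃ i, D₂.1.mate (Sum.inr a) = Sum.inl i := by
          cases hc : D₂.1.mate (Sum.inr a) with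
          | inl i => exact ⟨i, rfl⟩
          | inr c => exact absurd (Or.inl ⟨c, hc⟩) hxy
        have hj : ∃ j, D₂.1.mate (Sum.inr b) = Sum.inl j := by
          cases hc : D₂.1.mate (Sum.inr b) with
          | inl i => exact ⟨i, rfl⟩
          | inr c => exact absurd (Or.inr ⟨c, hc⟩) hxy
        obtain ⟨i, hi⟩ := hi
        obtain ⟨j, hj⟩ := hj
        rw [TLDiagram.stateSum_eq_zero A h₁ hi hj, diagramForm,
          if_neg (TLDiagram.not_productIsMonic hi hj hE), mul_zero]
    · obtain rfl : D₁ = D₂ := Subtype.ext (TLDiagram.eq_of_mismatches_eq_empty D₁.2 D₂.2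
        (Set.not_nonempty_iff_eq_empty.1 h))
      obtain ⟨H, rfl⟩ := (HalfDiagram.equivMonic t n).surjective D₁
      rw [diagramForm, if_pos (TLDiagram.productIsMonic_self (Subtype.prop _)),
        TLDiagram.loops_self, HalfDiagram.equivMonic_apply_val, HalfDiagram.stateSum_toTLDiagram,
        HalfDiagram.vec, HalfDiagram.pairing_act_self A H _
          (TLDiagram.card_openers H.isMonic_toTLDiagram), HalfDiagram.pairing_top, hAδ, mul_one]

namespace HalfDiagram

theorem diagramForm_equivMonic {A q : ℂ} (hA : A ^ 2 = -q) (hq : q ≠ 0) (hδ : q + q⁻¹ ≠ 0)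
    {t n : ℕ} (D D' : HalfDiagram t n) :
    diagramForm q (equivMonic t n D) (equivMonic t n D') = gram A t n D D' := by
  have hA0 : A ≠ 0 := by rintro rfl; simp at hA; exact hq hA
  have h := stateSum_eq_diagramForm hA hq hδ (equivMonic t n D) (equivMonic t n D')
  rw [equivMonic_apply_val, equivMonic_apply_val, stateSum_toTLDiagram] at h
  exact (mul_left_cancel₀ (pow_ne_zero _ (inv_ne_zero hA0)) h).symm

end HalfDiagram

/-! ### Dimensions as numbers of diagrams and ranks -/

theorem finrank_cellModule (t n : ℕ) :
    Module.finrank ℂ (CellModule t n) = HalfDiagram.count t n := by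
  have : Fintype (MonicTLDiagram t n) := Fintype.ofEquiv _ (HalfDiagram.equivMonic t n)
  rw [Module.finrank_finsupp_self, HalfDiagram.count,
    Fintype.card_congr (HalfDiagram.equivMonic t n)]

/-- The Gram matrix of the invariant form, indexed by half diagrams. -/
noncomputable def formMatrix (q : ℂ) (t n : ℕ) :
    Matrix (HalfDiagram t n) (HalfDiagram t n) ℂ :=
  Matrix.of fun D D' =>
    diagramForm q (HalfDiagram.equivMonic t n D) (HalfDiagram.equivMonic t n D')

/-- The quotient by the kernel is the range of the form in the dual space, which in coordinates is
the row space of the Gram matrix. -/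
theorem finrank_simpleTLModule (q : ℂ) (t n : ℕ) :
    Module.finrank ℂ (SimpleTLModule q t n) = (formMatrix q t n).rank := by
  have : Fintype (MonicTLDiagram t n) := Fintype.ofEquiv _ (HalfDiagram.equivMonic t n)
  let e := (Finsupp.llift ℂ ℂ ℂ (MonicTLDiagram t n)).symm
  let M : Matrix (MonicTLDiagram t n) (MonicTLDiagram t n) ℂ :=
    Matrix.of fun D D' => diagramForm q D D'
  have hM : (formMatrix q t n).rank = M.rank :=
    Matrix.rank_submatrix M (HalfDiagram.equivMonic t n) (HalfDiagram.equivMonic t n)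
  have hrange : (LinearMap.range (cellForm q t n)).map e.toLinearMap =
      Submodule.span ℂ (Set.range M.row) := by
    rw [cellForm, Finsupp.range_linearCombination, Submodule.map_span, ← Set.range_comp]
    congr 2
    ext D D'
    simp [e, M, Matrix.row]
  rw [hM, Matrix.rank_eq_finrank_span_row, ← hrange, LinearEquiv.finrank_map_eq]
  exact (cellForm q t n).quotKerEquivRange.finrank_eq

/-! ### Quantum integers at a root of unity -/

namespace SpinVec

variable {q : ℂ} {ℓ : ℕ}

theorem ne_zero_of_orderOf (hℓ : 3 ≤ ℓ) (hq : orderOf (q ^ 2) = ℓ) : q ≠ 0 := by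
  rintro rfl
  rw [zero_pow two_ne_zero] at hq
  have h := pow_orderOf_eq_one (0 : ℂ)
  rw [hq, zero_pow (by omega)] at h
  exact zero_ne_one h

theorem sub_inv_ne_zero (hℓ : 3 ≤ ℓ) (hq : orderOf (q ^ 2) = ℓ) : q - q⁻¹ ≠ 0 := by
  have h0 := ne_zero_of_orderOf hℓ hq
  intro h
  have h1 : q ^ 2 = 1 := by
    field_simp at h
    linear_combination h
  rw [h1, orderOf_one] at hq
  omega

theorem pow_eq_inv_pow_iff (h0 : q ≠ 0) (hq : orderOf (q ^ 2) = ℓ) (m : ℕ) :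
    q ^ m = q⁻¹ ^ m ↔ ℓ ∣ m := by
  rw [← hq, orderOf_dvd_iff_pow_eq_one, inv_pow, ← mul_eq_one_iff_eq_inv₀ (pow_ne_zero m h0),
    ← pow_add, ← pow_mul, two_mul]

theorem qInt_eq_zero_iff (hℓ : 3 ≤ ℓ) (hq : orderOf (q ^ 2) = ℓ) (m : ℕ) :
    qInt q m = 0 ↔ ℓ ∣ m := by
  rw [← pow_eq_inv_pow_iff (ne_zero_of_orderOf hℓ hq) hq, ← sub_eq_zero (a := q ^ m), ← qInt_mul]
  simp [sub_inv_ne_zero hℓ hq]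

/-- This number is [2], and ℓ ≥ 3 does not divide 2. It makes the loop value invertible. -/
theorem add_inv_ne_zero (hℓ : 3 ≤ ℓ) (hq : orderOf (q ^ 2) = ℓ) : q + q⁻¹ ≠ 0 := by
  have h : qInt q 2 ≠ 0 := by
    rw [ne_eq, qInt_eq_zero_iff hℓ hq]
    intro h
    have := Nat.le_of_dvd (by norm_num) h
    omega
  simpa [qInt, add_comm] using h

end SpinVec

/-! ### Rank recursion for the form -/

namespace HalfDiagram

theorem formMatrix_eq_gram {A q : ℂ} (hA : A ^ 2 = -q) (hq : q ≠ 0) (hδ : q + q⁻¹ ≠ 0) (t n : ℕ) :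
    formMatrix q t n = gram A t n := by
  ext D D'
  exact diagramForm_equivMonic hA hq hδ D D'

theorem rank_formMatrix_zero_zero {q : ℂ} (hq : q ≠ 0) (hδ : q + q⁻¹ ≠ 0) :
    (formMatrix q 0 0).rank = 1 := by
  obtain ⟨A, hA⟩ := IsAlgClosed.exists_pow_nat_eq (-q) two_pos
  rw [formMatrix_eq_gram hA hq hδ, Matrix.rank_of_isUnit, Fintype.card_unique]
  rw [Matrix.isUnit_iff_isUnit_det, Matrix.det_unique]
  simp [gram, vec, act, SpinVec.top, default]

theorem rank_formMatrix_of_lt (q : ℂ) {t n : ℕ} (h : n < t) : (formMatrix q t n).rank = 0 := by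
  have := isEmpty_of_lt h
  have := (formMatrix q t n).rank_le_card_height
  rw [Fintype.card_eq_zero] at this
  omega

theorem rank_formMatrix_zero_succ {q : ℂ} (hq : q ≠ 0) (hδ : q + q⁻¹ ≠ 0) (n : ℕ) :
    (formMatrix q 0 (n + 1)).rank = (formMatrix q 1 n).rank := by
  obtain ⟨A, hA⟩ := IsAlgClosed.exists_pow_nat_eq (-q) two_pos
  rw [formMatrix_eq_gram hA hq hδ, formMatrix_eq_gram hA hq hδ]
  exact rank_gram_zero_succ hA hq n (by simpa [qInt, add_comm] using hδ)

theorem rank_formMatrix_succ_succ {q : ℂ} (hq : q ≠ 0) (hδ : q + q⁻¹ ≠ 0) (t n : ℕ)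
    (ht : qInt q (t + 2) ≠ 0) :
    (formMatrix q (t + 1) (n + 1)).rank = (formMatrix q t n).rank +
      if qInt q (t + 3) = 0 then 0 else (formMatrix q (t + 2) n).rank := by
  obtain ⟨A, hA⟩ := IsAlgClosed.exists_pow_nat_eq (-q) two_pos
  simp only [formMatrix_eq_gram hA hq hδ]
  exact rank_gram_succ_succ hA hq t n ht

/-! ### Order of vanishing of the Gram determinant -/

open Filter Topology

/-- The order of vanishing of the quantum integer `[m]` at a root of unity. -/
def vanishing (ℓ m : ℕ) : ℤ := if ℓ ∣ m then 1 else 0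

theorem analyticAt_qInt {q : ℂ} (hq : q ≠ 0) (m : ℕ) : AnalyticAt ℂ (fun z => qInt z m) q := by
  induction m with
  | zero => exact analyticAt_const
  | succ m ih => exact ((analyticAt_inv hq).mul ih).add (analyticAt_id.pow m)

/-- A zero is simple because q times the derivative of z^m - z⁻ᵐ at q is m(q^m + q⁻ᵐ) = 2m q^m when
ℓ ∣ m. -/
theorem meromorphicOrderAt_qInt {q : ℂ} {ℓ : ℕ} (hℓ : 3 ≤ ℓ) (hq : orderOf (q ^ 2) = ℓ) {m : ℕ}
    (hm : m ≠ 0) : meromorphicOrderAt (fun z => qInt z m) q = (vanishing ℓ m : ℤ) := by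
  have h0 := ne_zero_of_orderOf hℓ hq
  have han := analyticAt_qInt h0 m
  rw [han.meromorphicOrderAt_eq, vanishing]
  split_ifs with hd
  · have hzero := (qInt_eq_zero_iff hℓ hq m).2 hd
    have hderiv : deriv (fun z => qInt z m) q ≠ 0 := by
      have h1 : HasDerivAt (fun z => qInt z m * (z - z⁻¹))
          (deriv (fun z => qInt z m) q * (q - q⁻¹) + qInt q m * (1 - -(q ^ 2)⁻¹)) q :=
        han.differentiableAt.hasDerivAt.mul ((hasDerivAt_id q).sub (hasDerivAt_inv h0))
      have h2 : HasDerivAt (fun z : ℂ => z ^ m - z⁻¹ ^ m)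
          (m * q ^ (m - 1) - m * q⁻¹ ^ (m - 1) * -(q ^ 2)⁻¹) q :=
        (hasDerivAt_pow m q).sub ((hasDerivAt_inv h0).pow m)
      simp only [qInt_mul] at h1
      have h3 := h1.unique h2
      rw [hzero] at h3
      intro hd0
      rw [hd0, zero_mul, zero_mul, add_zero] at h3
      have hpow := (pow_eq_inv_pow_iff h0 hq m).2 hd
      obtain ⟨k, rfl⟩ := Nat.exists_eq_succ_of_ne_zero hm
      have h4 : (2 * (k + 1 : ℕ) : ℂ) * q ^ (k + 1) = 0 := by
        simp only [Nat.succ_eq_add_one, Nat.add_sub_cancel] at h3 hpow ⊢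
        calc _ = ((k + 1 : ℕ) : ℂ) * (q ^ (k + 1) + q⁻¹ ^ (k + 1)) := by rw [← hpow]; ring
          _ = q * (((k + 1 : ℕ) : ℂ) * q ^ k - ((k + 1 : ℕ) : ℂ) * q⁻¹ ^ k * -(q ^ 2)⁻¹) := by
            rw [pow_succ, pow_succ]; field_simp; ring
          _ = 0 := by rw [← h3, mul_zero]
      have h5 : ((k + 1 : ℕ) : ℂ) ≠ 0 := Nat.cast_ne_zero.2 (Nat.succ_ne_zero k)
      exact (mul_ne_zero (mul_ne_zero two_ne_zero h5) (pow_ne_zero _ h0)) h4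
    have := han.analyticOrderAt_sub_eq_one_of_deriv_ne_zero hderiv
    simp only [hzero, sub_zero] at this
    rw [this]
    rfl
  · rw [han.analyticOrderAt_eq_zero.2 (mt (qInt_eq_zero_iff hℓ hq m).1 hd)]
    rfl

theorem eventually_qInt_ne_zero {q : ℂ} {ℓ : ℕ} (hℓ : 3 ≤ ℓ) (hq : orderOf (q ^ 2) = ℓ) {m : ℕ}
    (hm : m ≠ 0) : ∀ᶠ z in 𝓝[≠] q, qInt z m ≠ 0 := by
  rw [← meromorphicOrderAt_ne_top_iff_eventually_ne_zero
    (analyticAt_qInt (ne_zero_of_orderOf hℓ hq) m).meromorphicAt, meromorphicOrderAt_qInt hℓ hq hm]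
  exact WithTop.coe_ne_top

/-- The entries are zero or powers of -(z + z⁻¹), with exponents independent of z. No square root of
-z enters, unlike in `gram`. -/
theorem analyticAt_det_formMatrix {q : ℂ} (hq : q ≠ 0) (t n : ℕ) :
    AnalyticAt ℂ (fun z => (formMatrix z t n).det) q := by
  simp only [Matrix.det_apply']
  refine Finset.analyticAt_fun_sum _ fun σ _ => analyticAt_const.mul ?_
  refine Finset.analyticAt_fun_prod _ fun D _ => ?_
  simp only [formMatrix, Matrix.of_apply, diagramForm]
  split_ifs
  · exact (analyticAt_id.add (analyticAt_inv hq)).neg.pow _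
  · exact analyticAt_const

theorem eventually_generic {q : ℂ} (hq : q ≠ 0) (hδ : q + q⁻¹ ≠ 0) :
    ∀ᶠ z in 𝓝[≠] q, z ≠ 0 ∧ z + z⁻¹ ≠ 0 := by
  apply Filter.Eventually.filter_mono nhdsWithin_le_nhds
  exact (continuousAt_id.eventually_ne hq).and
    ((continuousAt_id.add (continuousAt_inv₀ hq)).eventually_ne hδ)

/-- The order of vanishing of the Gram determinant at a root of unity. -/
noncomputable def detOrder (ℓ N t n : ℕ) : ℤ :=
  ∑ j ∈ Finset.range N,
    (count (t + 2 + 2 * j) n : ℤ) * (vanishing ℓ (t + 2 + j) - vanishing ℓ (j + 1))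

theorem detOrder_zero_right (ℓ N t : ℕ) : detOrder ℓ N t 0 = 0 := by
  refine Finset.sum_eq_zero fun j _ => ?_
  rw [count_of_lt (by omega)]
  simp

theorem detOrder_succ_succ {ℓ N n : ℕ} (hn : n < N) (t : ℕ) :
    detOrder ℓ N (t + 1) (n + 1) = detOrder ℓ N t n +
      ((count (t + 2) n : ℤ) * (vanishing ℓ (t + 3) - vanishing ℓ (t + 2)) +
        detOrder ℓ N (t + 2) n) := by
  -- After the counts for n + 1 are split, the difference of the two sides telescopes in j. The end
  -- term vanishes because N > n exceeds the number of nonzero terms, and the initial term is the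
  -- new ratio [t+3]/[t+2].
  have h := Finset.sum_range_sub (fun j => (count (t + 2 + 2 * j) n : ℤ) *
    (vanishing ℓ (t + 3 + j) - vanishing ℓ (t + 2 + j))) N
  rw [count_of_lt (show n < t + 2 + 2 * N by omega)] at h
  simp only [mul_zero, add_zero, Nat.cast_zero, zero_mul, zero_sub] at h
  rw [← sub_eq_iff_eq_add', ← sub_eq_iff_eq_add, ← neg_eq_iff_eq_neg.2 h, ← Finset.sum_neg_distrib]
  rw [detOrder, detOrder, detOrder, ← Finset.sum_sub_distrib, ← Finset.sum_sub_distrib]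
  refine Finset.sum_congr rfl fun j _ => ?_
  have e1 : count (t + 1 + 2 + 2 * j) (n + 1) =
      count (t + 2 + 2 * j) n + count (t + 2 + 2 + 2 * j) n := by
    have := count_succ_succ (t + 2 + 2 * j) n
    rw [show t + 2 + 2 * j + 1 = t + 1 + 2 + 2 * j by ring,
      show t + 2 + 2 * j + 2 = t + 2 + 2 + 2 * j by ring] at this
    exact this
  rw [e1, show t + 2 + 2 * (j + 1) = t + 2 + 2 + 2 * j by ring,
    show t + 3 + (j + 1) = t + 2 + 2 + j by ring, show t + 2 + (j + 1) = t + 1 + 2 + j by ring,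
    show t + 3 + j = t + 1 + 2 + j by ring]
  push_cast
  ring

theorem detOrder_zero_succ {ℓ N n : ℕ} (hn : n < N) :
    detOrder ℓ N 0 (n + 1) =
      (count 1 n : ℤ) * (vanishing ℓ 2 - vanishing ℓ 1) + detOrder ℓ N 1 n := by
  have h := Finset.sum_range_sub (fun j => (count (1 + 2 * j) n : ℤ) *
    (vanishing ℓ (2 + j) - vanishing ℓ (1 + j))) N
  rw [count_of_lt (show n < 1 + 2 * N by omega)] at h
  simp only [mul_zero, add_zero, Nat.cast_zero, zero_mul, zero_sub] at h
  rw [← sub_eq_iff_eq_add, ← neg_eq_iff_eq_neg.2 h, ← Finset.sum_neg_distrib]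
  rw [detOrder, detOrder, ← Finset.sum_sub_distrib]
  refine Finset.sum_congr rfl fun j _ => ?_
  have e1 : count (0 + 2 + 2 * j) (n + 1) = count (1 + 2 * j) n + count (1 + 2 + 2 * j) n := by
    have := count_succ_succ (1 + 2 * j) n
    rw [show 1 + 2 * j + 1 = 0 + 2 + 2 * j by ring,
      show 1 + 2 * j + 2 = 1 + 2 + 2 * j by ring] at this
    exact this
  rw [e1, show 1 + 2 * (j + 1) = 1 + 2 + 2 * j by ring,
    show 2 + (j + 1) = 1 + 2 + j by ring, show 1 + (j + 1) = 2 + j by ring,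
    show 0 + 2 + j = 2 + j by ring, show 1 + j = j + 1 by ring]
  push_cast
  ring

theorem meromorphicOrderAt_qInt_ratio {q : ℂ} {ℓ : ℕ} (hℓ : 3 ≤ ℓ) (hq : orderOf (q ^ 2) = ℓ)
    (m k : ℕ) : MeromorphicAt (fun z => (-(qInt z (m + 2) / qInt z (m + 1))) ^ k) q ∧
    meromorphicOrderAt (fun z => (-(qInt z (m + 2) / qInt z (m + 1))) ^ k) q =
      (((k : ℤ) * (vanishing ℓ (m + 2) - vanishing ℓ (m + 1)) : ℤ) : WithTop ℤ) := by
  have h0 := ne_zero_of_orderOf hℓ hq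
  have h1 := (analyticAt_qInt h0 (m + 2)).meromorphicAt
  have h2 := (analyticAt_qInt h0 (m + 1)).meromorphicAt
  have h3 : MeromorphicAt (fun z => -(qInt z (m + 2) / qInt z (m + 1))) q := (h1.div h2).neg
  refine ⟨h3.pow k, ?_⟩
  have h4 : meromorphicOrderAt (fun z => -(qInt z (m + 2) / qInt z (m + 1))) q =
      ((vanishing ℓ (m + 2) - vanishing ℓ (m + 1) : ℤ) : WithTop ℤ) := by
    rw [← meromorphicOrderAt_fun_neg, fun_meromorphicOrderAt_div h1 h2,
      meromorphicOrderAt_qInt hℓ hq (by omega), meromorphicOrderAt_qInt hℓ hq (by omega)]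
    rfl
  rw [fun_meromorphicOrderAt_pow h3, h4]
  norm_cast

/-- The determinant recursions hold in a punctured neighbourhood of q, where the quantum integers in
the denominators do not vanish, and this suffices to compare orders, even if they vanish at q
itself. -/
theorem meromorphicOrderAt_det_formMatrix {q : ℂ} {ℓ : ℕ} (hℓ : 3 ≤ ℓ)
    (hq : orderOf (q ^ 2) = ℓ) {N n : ℕ} (hn : n ≤ N) (t : ℕ) :
    meromorphicOrderAt (fun z => (formMatrix z t n).det) q = (detOrder ℓ N t n : ℤ) := by
  have h0 := ne_zero_of_orderOf hℓ hq
  have hδ := add_inv_ne_zero hℓ hq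
  have hmer (t n : ℕ) := (analyticAt_det_formMatrix h0 t n).meromorphicAt
  induction n generalizing t with
  | zero =>
    have h1 : ∀ᶠ z in 𝓝[≠] q, (formMatrix z t 0).det = 1 := by
      filter_upwards [eventually_generic h0 hδ] with z hz
      cases t with
      | zero =>
        obtain ⟨A, hA⟩ := IsAlgClosed.exists_pow_nat_eq (-z) two_pos
        rw [formMatrix_eq_gram hA hz.1 hz.2, Matrix.det_unique]
        simp [gram, vec, act, SpinVec.top, default]
      | succ t => exact Matrix.det_isEmpty
    rw [meromorphicOrderAt_congr h1, detOrder_zero_right]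
    classical
    rw [meromorphicOrderAt_const]
    simp
  | succ n ih =>
    cases t with
    | zero =>
      have h1 : ∀ᶠ z in 𝓝[≠] q, (formMatrix z 0 (n + 1)).det =
          (-(qInt z (0 + 2) / qInt z (0 + 1))) ^ count 1 n * (formMatrix z 1 n).det := by
        filter_upwards [eventually_generic h0 hδ] with z hz
        obtain ⟨A, hA⟩ := IsAlgClosed.exists_pow_nat_eq (-z) two_pos
        rw [formMatrix_eq_gram hA hz.1 hz.2, formMatrix_eq_gram hA hz.1 hz.2]
        exact det_gram_zero_succ hA hz.1 n
      obtain ⟨m1, o1⟩ := meromorphicOrderAt_qInt_ratio hℓ hq 0 (count 1 n)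
      rw [meromorphicOrderAt_congr h1, fun_meromorphicOrderAt_mul m1 (hmer 1 n), o1,
        ih (by omega), detOrder_zero_succ (by omega)]
      rfl
    | succ t =>
      have h1 : ∀ᶠ z in 𝓝[≠] q, (formMatrix z (t + 1) (n + 1)).det = (formMatrix z t n).det *
          ((-(qInt z (t + 1 + 2) / qInt z (t + 1 + 1))) ^ count (t + 2) n *
            (formMatrix z (t + 2) n).det) := by
        filter_upwards [eventually_generic h0 hδ,
          eventually_qInt_ne_zero hℓ hq (show t + 2 ≠ 0 by omega)] with z hz hz'
        obtain ⟨A, hA⟩ := IsAlgClosed.exists_pow_nat_eq (-z) two_pos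
        simp only [formMatrix_eq_gram hA hz.1 hz.2]
        exact det_gram_succ_succ hA hz.1 t n hz'
      obtain ⟨m1, o1⟩ := meromorphicOrderAt_qInt_ratio hℓ hq (t + 1) (count (t + 2) n)
      rw [meromorphicOrderAt_congr h1,
        fun_meromorphicOrderAt_mul (hmer t n) (m1.fun_mul (hmer (t + 2) n)),
        fun_meromorphicOrderAt_mul m1 (hmer (t + 2) n), o1,
        ih (by omega), ih (by omega), detOrder_succ_succ (by omega)]
      rfl

/-- Since t + 2 + j ≡ j + 1 modulo ℓ, zeros and poles cancel term by term. An analytic determinant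
of order zero does not vanish at q. -/
theorem rank_formMatrix_of_dvd {q : ℂ} {ℓ : ℕ} (hℓ : 3 ≤ ℓ) (hq : orderOf (q ^ 2) = ℓ) {t : ℕ}
    (ht : ℓ ∣ t + 1) (n : ℕ) : (formMatrix q t n).rank = count t n := by
  have h0 := ne_zero_of_orderOf hℓ hq
  have hord := meromorphicOrderAt_det_formMatrix hℓ hq le_rfl t (n := n)
  have hzero : detOrder ℓ n t n = 0 := by
    refine Finset.sum_eq_zero fun j _ => ?_
    have hd : ℓ ∣ t + 2 + j ↔ ℓ ∣ j + 1 := by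
      rw [show t + 2 + j = (t + 1) + (j + 1) by ring]
      exact Nat.dvd_add_right ht
    have : vanishing ℓ (t + 2 + j) = vanishing ℓ (j + 1) := by simp only [vanishing, hd]
    rw [this, sub_self, mul_zero]
  have han := analyticAt_det_formMatrix h0 t n
  rw [hzero, han.meromorphicOrderAt_eq] at hord
  have hne : (formMatrix q t n).det ≠ 0 := by
    apply han.analyticOrderAt_eq_zero.1
    cases ho : analyticOrderAt (fun z => (formMatrix z t n).det) q with
    | top => rw [ho] at hord; cases hord
    | coe k =>
      rw [ho] at hord
      have : ((k : ℤ) : WithTop ℤ) = ((0 : ℤ) : WithTop ℤ) := hord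
      simpa using this
  rw [Matrix.rank_of_isUnit, count]
  rw [Matrix.isUnit_iff_isUnit_det]
  exact hne.isUnit

end HalfDiagram

/-! ### Generating functions and their recursions -/

namespace PowerSeries

/-- The differences are divisible by every power of X, by induction on the exponent and, inside it,
on t. The factors a and b are free, so a = b = 0 covers an index at which F and G are already known
to agree. -/
theorem eq_of_recursion {R : Type*} [CommRing R] {F G : ℕ → R⟦X⟧}
    (h0 : F 0 - G 0 = X * (F 1 - G 1))
    (h : ∀ t, ∃ a b : R⟦X⟧,
      F (t + 1) - G (t + 1) = a * (F t - G t) + X * (b * (F (t + 2) - G (t + 2)))) (t : ℕ) :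
    F t = G t := by
  have key (k : ℕ) : ∀ t, (X : R⟦X⟧) ^ k ∣ F t - G t := by
    induction k with
    | zero => simp
    | succ k ih =>
      intro t
      induction t with
      | zero =>
        rw [h0, pow_succ']
        exact mul_dvd_mul_left _ (ih 1)
      | succ t iht =>
        obtain ⟨a, b, hab⟩ := h t
        rw [hab]
        refine dvd_add (dvd_mul_of_dvd_right iht a) ?_
        rw [pow_succ']
        exact mul_dvd_mul_left _ (dvd_mul_of_dvd_right (ih _) b)
  refine sub_eq_zero.1 (PowerSeries.ext fun k => ?_)
  exact X_pow_dvd_iff.1 (key (k + 1) t) k (Nat.lt_succ_self k)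

end PowerSeries

theorem catalanC_eq_map : catalanC = PowerSeries.map (Nat.castRingHom ℚ) catalanSeries := by
  ext n
  have h := succ_mul_catalan_eq_centralBinom n
  have h' : ((n : ℚ) + 1) * (catalan n : ℚ) = (Nat.choose (2 * n) n : ℚ) := by
    rw [← Nat.centralBinom_eq_two_mul_choose]
    exact_mod_cast h
  rw [catalanC, coeff_mk, coeff_map, ← h', catalanSeries, coeff_mk, eq_natCast]
  have : (n : ℚ) + 1 ≠ 0 := by positivity
  field_simp

theorem catalanC_eq : catalanC = 1 + X * catalanC ^ 2 := by
  have h := congrArg (PowerSeries.map (Nat.castRingHom ℚ)) catalanSeries_sq_mul_X_add_one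
  rw [map_add, map_mul, map_pow, map_one, PowerSeries.map_X, ← catalanC_eq_map] at h
  linear_combination -h

theorem catalanD_add_one : catalanD + 1 = catalanC := sub_add_cancel _ _

theorem X_mul_catalanC_sq : X * catalanC ^ 2 = catalanD := by
  rw [catalanD]
  linear_combination -catalanC_eq

theorem constantCoeff_catalanD : constantCoeff catalanD = 0 := by
  simp [← X_mul_catalanC_sq]

theorem one_sub_catalanD_pow_mul_inv {ℓ : ℕ} (hℓ : ℓ ≠ 0) :
    (1 - catalanD ^ ℓ) * (1 - catalanD ^ ℓ)⁻¹ = 1 :=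
  PowerSeries.mul_inv_cancel _ (by simp [constantCoeff_catalanD, hℓ])

theorem cellSeries_zero : cellSeries 0 = 1 + X * cellSeries 1 := by
  ext k
  cases k with
  | zero => simp [cellSeries, finrank_cellModule, HalfDiagram.count_zero_zero]
  | succ k =>
    rw [map_add, coeff_succ_X_mul]
    simp only [cellSeries, coeff_mk, finrank_cellModule, coeff_one]
    rw [show 0 + 2 * (k + 1) = 1 + 2 * k + 1 by ring, HalfDiagram.count_zero_succ]
    simp

theorem cellSeries_succ (t : ℕ) :
    cellSeries (t + 1) = cellSeries t + X * cellSeries (t + 2) := by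
  ext k
  cases k with
  | zero =>
    simp [cellSeries, finrank_cellModule, HalfDiagram.count_succ_succ,
      HalfDiagram.count_of_lt (show t < t + 2 by omega)]
  | succ k =>
    rw [map_add, coeff_succ_X_mul]
    simp only [cellSeries, coeff_mk, finrank_cellModule]
    rw [show t + 1 + 2 * (k + 1) = t + 2 * (k + 1) + 1 by ring, HalfDiagram.count_succ_succ,
      show t + 2 + 2 * k = t + 2 * (k + 1) by ring, Nat.cast_add]

theorem cellSeries_eq_catalanC_pow (t : ℕ) : cellSeries t = catalanC ^ (t + 1) := by
  refine eq_of_recursion (F := cellSeries) (G := fun t => catalanC ^ (t + 1)) ?_ (fun t => ?_) t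
  · rw [cellSeries_zero]
    linear_combination -catalanC_eq
  · refine ⟨1, 1, ?_⟩
    rw [cellSeries_succ]
    linear_combination -catalanC ^ (t + 1) * catalanC_eq

section

variable {q : ℂ} {ℓ : ℕ}

theorem simpleSeries_zero (hℓ : 3 ≤ ℓ) (hq : orderOf (q ^ 2) = ℓ) :
    simpleSeries q 0 = 1 + X * simpleSeries q 1 := by
  have h0 := SpinVec.ne_zero_of_orderOf hℓ hq
  have hδ := SpinVec.add_inv_ne_zero hℓ hq
  ext k
  cases k with
  | zero => simp [simpleSeries, finrank_simpleTLModule, HalfDiagram.rank_formMatrix_zero_zero h0 hδ]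
  | succ k =>
    rw [map_add, coeff_succ_X_mul]
    simp only [simpleSeries, coeff_mk, finrank_simpleTLModule, coeff_one]
    rw [show 0 + 2 * (k + 1) = 1 + 2 * k + 1 by ring, HalfDiagram.rank_formMatrix_zero_succ h0 hδ]
    simp

theorem simpleSeries_succ (hℓ : 3 ≤ ℓ) (hq : orderOf (q ^ 2) = ℓ) {t : ℕ} (ht : ¬ ℓ ∣ t + 2) :
    simpleSeries q (t + 1) =
      simpleSeries q t + X * ((if ℓ ∣ t + 3 then 0 else 1) * simpleSeries q (t + 2)) := by
  have h0 := SpinVec.ne_zero_of_orderOf hℓ hq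
  have hδ := SpinVec.add_inv_ne_zero hℓ hq
  have hrec (n : ℕ) := HalfDiagram.rank_formMatrix_succ_succ h0 hδ t n
    ((SpinVec.qInt_eq_zero_iff hℓ hq _).not.2 ht)
  simp only [SpinVec.qInt_eq_zero_iff hℓ hq] at hrec
  ext k
  cases k with
  | zero =>
    have h := HalfDiagram.rank_formMatrix_of_lt q (show t < t + 2 by omega)
    split_ifs at hrec ⊢ <;> simp [simpleSeries, finrank_simpleTLModule, hrec, h]
  | succ k =>
    rw [map_add, coeff_succ_X_mul]
    have h1 := hrec (t + 2 * (k + 1))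
    rw [show t + 2 * (k + 1) + 1 = t + 1 + 2 * (k + 1) by ring] at h1
    split_ifs at h1 ⊢
    · simp [simpleSeries, finrank_simpleTLModule, h1]
    · simp only [simpleSeries, finrank_simpleTLModule, coeff_mk, one_mul]
      rw [h1, show t + 2 + 2 * k = t + 2 * (k + 1) by ring, Nat.cast_add]

theorem simpleSeries_of_dvd (hℓ : 3 ≤ ℓ) (hq : orderOf (q ^ 2) = ℓ) {t : ℕ} (ht : ℓ ∣ t + 1) :
    simpleSeries q t = cellSeries t := by
  ext k
  simp [simpleSeries, cellSeries, finrank_simpleTLModule, finrank_cellModule,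
    HalfDiagram.rank_formMatrix_of_dvd hℓ hq ht]

end

/-! ### The closed form -/

/-- The generating function of the dimensions of the simple modules, as a function of `t`. -/
noncomputable def simpleClosedForm (ℓ t : ℕ) : ℚ⟦X⟧ :=
  if t % ℓ = ℓ - 1 then catalanC ^ (t + 1)
  else catalanC ^ (t + 1) * (1 - catalanD ^ (ℓ - 1 - t % ℓ)) * (1 - catalanD ^ ℓ)⁻¹

theorem mod_eq_pred_iff {ℓ : ℕ} (hℓ : 2 ≤ ℓ) (t : ℕ) : t % ℓ = ℓ - 1 ↔ ℓ ∣ t + 1 := by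
  have := Nat.mod_lt t (show 0 < ℓ by omega)
  rw [Nat.dvd_iff_mod_eq_zero, Nat.add_mod_eq_ite, Nat.mod_eq_of_lt hℓ]
  generalize t % ℓ = r at *
  refine ⟨fun h => ?_, fun h => ?_⟩
  · rw [if_pos (by omega)]
    omega
  · split_ifs at h <;> omega

theorem simpleClosedForm_zero {ℓ : ℕ} (hℓ : 3 ≤ ℓ) :
    simpleClosedForm ℓ 0 = 1 + X * simpleClosedForm ℓ 1 := by
  obtain ⟨m, rfl⟩ := Nat.exists_eq_add_of_le' hℓ
  have h1 := one_sub_catalanD_pow_mul_inv (ℓ := m + 3) (by omega)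
  have h2 : X * catalanC ^ 2 = catalanD := X_mul_catalanC_sq
  have h3 := catalanD_add_one
  rw [simpleClosedForm, simpleClosedForm, Nat.zero_mod, Nat.mod_eq_of_lt (by omega : 1 < m + 3),
    if_neg (by omega), if_neg (by omega), show m + 3 - 1 - 0 = m + 2 by omega,
    show m + 3 - 1 - 1 = m + 1 by omega, ← h3]
  rw [← h3] at h2
  generalize (1 - catalanD ^ (m + 3))⁻¹ = u at *
  linear_combination h1 - (1 - catalanD ^ (m + 1)) * u * h2

theorem simpleClosedForm_succ {ℓ t : ℕ} (hℓ : 3 ≤ ℓ) (ht : ¬ ℓ ∣ t + 2) :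
    simpleClosedForm ℓ (t + 1) =
      simpleClosedForm ℓ t + X * ((if ℓ ∣ t + 3 then 0 else 1) * simpleClosedForm ℓ (t + 2)) := by
  have h1 := one_sub_catalanD_pow_mul_inv (ℓ := ℓ) (by omega)
  have h2 : X * catalanC ^ 2 = catalanD := X_mul_catalanC_sq
  rw [← catalanD_add_one] at h2
  have ht' := (mod_eq_pred_iff (by omega : 2 ≤ ℓ) (t + 1)).not.2 ht
  have hb := Nat.mod_lt t (show 0 < ℓ by omega)
  have e1 : (t + 1) % ℓ = if ℓ ≤ t % ℓ + 1 then t % ℓ + 1 - ℓ else t % ℓ + 1 := by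
    rw [Nat.add_mod_eq_ite, Nat.mod_eq_of_lt (by omega : 1 < ℓ)]
  have e2 : (t + 2) % ℓ = if ℓ ≤ t % ℓ + 2 then t % ℓ + 2 - ℓ else t % ℓ + 2 := by
    rw [Nat.add_mod_eq_ite, Nat.mod_eq_of_lt (by omega : 2 < ℓ)]
  simp only [← mod_eq_pred_iff (by omega : 2 ≤ ℓ) (t + 2), simpleClosedForm, ← catalanD_add_one]
  rw [if_neg ht']
  generalize (1 - catalanD ^ ℓ)⁻¹ = u at *
  generalize t % ℓ = b at *
  -- The remainder ℓ - 2 is excluded by `ht`. For ℓ - 1 the series at t is a pure power of c, for ℓ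
  -- - 3 the term at t + 2 is dropped, and below that all three series have the generic form.
  rcases (by split_ifs at e1 <;> omega : b = ℓ - 1 ∨ b = ℓ - 3 ∨ b + 4 ≤ ℓ) with h | h | h
  · obtain ⟨m, rfl⟩ := Nat.exists_eq_add_of_le' hℓ
    rw [if_pos (by omega)] at e1 e2
    rw [if_pos h, if_neg (by omega), if_neg (by omega), show m + 3 - 1 - (t + 1) % (m + 3) = m + 2
      by omega, show m + 3 - 1 - (t + 2) % (m + 3) = m + 1 by omega]
    linear_combination (catalanD + 1) ^ (t + 1) * (h1 - (1 - catalanD ^ (m + 1)) * u * h2)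
  · obtain rfl : ℓ = b + 3 := by omega
    rw [if_neg (by omega)] at e1 e2
    simp only [show (t + 2) % (b + 3) = b + 3 - 1 by omega, show b ≠ b + 3 - 1 by omega, if_true,
      if_false, show b + 3 - 1 - (t + 1) % (b + 3) = 1 by omega, show b + 3 - 1 - b = 2 by omega]
    ring
  · obtain ⟨m, rfl⟩ := Nat.exists_eq_add_of_le' h
    rw [if_neg (by omega)] at e1 e2
    rw [if_neg (by omega), if_neg (by omega), if_neg (by omega),
      show m + (b + 4) - 1 - (t + 1) % (m + (b + 4)) = m + 2 by omega,
      show m + (b + 4) - 1 - (t + 2) % (m + (b + 4)) = m + 1 by omega,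
      show m + (b + 4) - 1 - b = m + 3 by omega]
    linear_combination -(catalanD + 1) ^ (t + 1) * (1 - catalanD ^ (m + 1)) * u * h2

theorem simpleSeries_eq_simpleClosedForm {q : ℂ} {ℓ : ℕ} (hℓ : 3 ≤ ℓ) (hq : orderOf (q ^ 2) = ℓ)
    (t : ℕ) : simpleSeries q t = simpleClosedForm ℓ t := by
  refine eq_of_recursion (F := simpleSeries q) (G := simpleClosedForm ℓ) ?_ (fun t => ?_) t
  · rw [simpleSeries_zero hℓ hq, simpleClosedForm_zero hℓ]
    ring
  · by_cases ht : ℓ ∣ t + 2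
    -- At this index the rank recursion is not available, but the form is nondegenerate and both
    -- series are the same power of c.
    · refine ⟨0, 0, ?_⟩
      rw [simpleSeries_of_dvd hℓ hq ht, cellSeries_eq_catalanC_pow, simpleClosedForm,
        if_pos ((mod_eq_pred_iff (by omega) _).2 ht)]
      ring
    · refine ⟨1, if ℓ ∣ t + 3 then 0 else 1, ?_⟩
      rw [simpleSeries_succ hℓ hq ht, simpleClosedForm_succ hℓ ht]
      ring

theorem mainTheorem1 (ℓ : ℕ) (hℓ : 3 ≤ ℓ) (q : ℂ) (hq : orderOf (q ^ 2) = ℓ) (t : ℕ) :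
    (t % ℓ = ℓ - 1 →
      simpleSeries q t = cellSeries t ∧ cellSeries t = catalanC ^ (t + 1)) ∧
    (t % ℓ ≤ ℓ - 2 →
      simpleSeries q t =
        (catalanD + 1) ^ (t + 1) * (1 - catalanD ^ (ℓ - 1 - t % ℓ)) * (1 - catalanD ^ ℓ)⁻¹) := by
  refine ⟨fun h => ⟨?_, cellSeries_eq_catalanC_pow t⟩, fun h => ?_⟩
  · exact simpleSeries_of_dvd hℓ hq ((mod_eq_pred_iff (by omega) t).1 h)
  · rw [simpleSeries_eq_simpleClosedForm hℓ hq, simpleClosedForm, if_neg (by omega),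
      catalanD_add_one]
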